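/- Fix integers $k\ge 0$ and $n>k$ and a rational $c>0$. **Codings.** Pairs of natural numbers are coded by $\langle x,y\rangle=\frac12(x^2+2xy+y^2+3x+y)$, sequences by $\langle x_1,\dots,x_n\rangle=\langle\langle x_1,\dots,x_{n-1}\rangle,x_n\rangle$, and $\pi_i^n\langle x_1,\dots,x_n\rangle=x_i$. Integers are coded by $\zeta(i)=2i$ for $i\ge0$ and $\zeta(i)=-2i-1$ for $i<0$, and rational numbers by $\rho(0)=0$ and $\rho(\pm\prod_p p^{e_p})=\zeta(\pm\prod_p p^{\zeta(e_p)})$. The number $[a;b]=\langle\rho(a),\rho(b)\rangle$ codes the open interval $\iota[a;b]=\{x\in\mathbb R: a<x<b\}$. Let $\mathcal I_{10,c}$ be the basis of all decimal intervals, i.e. the sets $\iota[a;b]$ with $a=\frac{m-c}{10^d}$ and $b=\frac{m+1+c}{10^d}$, where $m\in\mathbb Z$ and $d\ge1$; $d$ is the number of digits of precision. The $n$-fold effective product of $(\mathcal I_{10,c},\iota)$ has as basis the products of $n$ decimal intervals and as coding $\nu\langle u_1,\dots,u_n\rangle=\iota(u_1)\times\dots\times\iota(u_n)$. **Oracles and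 representations.** For a basis $\mathcal B$ with coding $\nu$, a set $\mathcal L\subseteq\mathcal B$ is a local basis for $x$ if every $L\in\mathcal L$ contains $x$ and every $B\in\mathcal B$ with $x\in B$ includes some $L\in\mathcal L$. A nested oracle for $x$ is a function $\phi:\mathbb N\to\{u:\nu(u)\in\mathcal B\}$ such that $\nu(\phi(\mathbb N))$ is a local basis for $x$ and $\nu(\phi(m+1))\subseteq\nu(\phi(m))$ for all $m$. A set $R\subseteq\{u:\nu(u)\in\mathcal B\}$ is a basic representation of a set $A$ of points if, for every point $x$, $x\in A$ if and only if $x$ has a local basis included in $\nu(R)$. **Kreisel's criterion.** Programs $\kappa_1,\dots,\kappa_{n-k}$, computing partial recursive functionals of $k$ function arguments (oracles) and one number argument, *compute* $\psi:\mathbb R^k\to\mathbb R^{n-k}$ if, whenever $\phi_1,\dots,\phi_k$ are nested oracles for real numbers $x_1,\dots,x_k$ in $(\mathcal I_{10,c},\iota)$ and $1\le j\le n-k$, the value $\kappa_j(\phi_1,\dots,\phi_k,m)$ is defined for all $m\in\mathbb N$ and $\lambda m[\kappa_j(\phi_1,\dots,\phi_k,m)]$ is a nested oracle in $(\mathcal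 I_{10,c},\iota)$ for the $j$-th coordinate of $\psi(x_1,\dots,x_k)$. **The class $\mathcal K_{k,n,c}$.** For a real number $p$, let $o_p(l)$ be the code of the decimal interval with $m=\lfloor 10^{l+1}p\rfloor$ and $d=l+1$. For the code $u$ of a decimal interval with midpoint $p$ and $d$ digits of precision, let $\sigma_u(l)=o_p(l)$ for $l<d$, and let $\sigma_u(l)$ be undefined for $l\ge d$. Given programs $\kappa_1,\dots,\kappa_{n-k}$ that compute some function $\mathbb R^k\to\mathbb R^{n-k}$, let $R$ be the set of all $\langle u_1,\dots,u_n\rangle$ such that $u_1,\dots,u_k$ are codes of decimal intervals and such that for each $j\le n-k$ there is an $m$ with $u_{k+j}=\kappa_j(\sigma_{u_1},\dots,\sigma_{u_k},m)$ (a value is undefined if the program calls an oracle where it is undefined). Let $H=\{\pi_1^n,\dots,\pi_n^n\}$. The class $\mathcal K_{k,n,c}$ consists of all pairs $(R,H)$ obtained in this way. **Theorem.** (1) There is a computable map $G$ from programs to $(n-k)$-tuples of programs for functionals with the following property. Suppose $(R,H)\in\mathcal K_{k,n,c}$ and $\psi:\mathbb R^k\to\mathbb R^{n-k}$ is a function whose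 graph has basic representation $R$ in the $n$-fold effective product of $(\mathcal I_{10,c},\iota)$. Then $R$ is recursively enumerable, and for every program $e$ that halts exactly on the members of $R$, the programs $\kappa_1,\dots,\kappa_{n-k}$ in the tuple $G(e)$ compute $\psi$ in the above sense. (2) The same prediction is possible from a computable physical model. A computable physical model is a pair $(T,B)$, where $T\subseteq\mathbb N$ is recursive and $B$ is a set of total recursive functions. An isomorphism from $(S,A)$ to $(T,B)$ consists of bijections $f:S\to T$ and $g:A\to B$ with $\alpha(s)=g(\alpha)(f(s))$ for all $s\in S$ and $\alpha\in A$. For $(R,H)$ and $\psi$ as in (1), $(R,H)$ is isomorphic to a computable physical model. Moreover, there is a computable map $P$, independent of $(R,H)$ and $\psi$, that takes a program deciding $T$ and programs computing $\beta_1,\dots,\beta_n$, for any computable physical model $(T,\{\beta_1,\dots,\beta_n\})$ isomorphic to $(R,H)$ by an isomorphism that sends $\pi_i^n$ to $\beta_i$ for each $i$, to programs $\kappa_1,\dots,\kappa_{n-k}$ that compute $\psi$. -/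

import Mathlib

/-! ### Codings of sequences, integers and rational numbers -/

/-- Cantor's pairing function `⟨x, y⟩ = (x² + 2xy + y² + 3x + y) / 2`. -/
def cantorPair (x y : ℕ) : ℕ := (x ^ 2 + 2 * x * y + y ^ 2 + 3 * x + y) / 2

/-- The code `⟨x₁, …, xₙ⟩ = ⟨⟨x₁, …, xₙ₋₁⟩, xₙ⟩` of a sequence of length `n ≥ 1`, with `⟨x₁⟩ = x₁`
(the value for `n = 0` is irrelevant). -/
def tupleCode : (n : ℕ) → (Fin n → ℕ) → ℕ
  | 0, _ => 0
  | 1, x => x 0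
  | n + 2, x => cantorPair (tupleCode (n + 1) fun i => x i.castSucc) (x (Fin.last (n + 1)))

/-- The projection function `πᵢⁿ`, with `πᵢⁿ⟨x₁, …, xₙ⟩ = xᵢ` (see `projection_tupleCode`). -/
noncomputable def projection (n : ℕ) (i : Fin n) (r : ℕ) : ℕ := Function.invFun (tupleCode n) r i

theorem cantorPair_eq (x y : ℕ) :
    cantorPair x y = (x + y) * (x + y + 1) / 2 + x := by
  unfold cantorPair
  have : x ^ 2 + 2 * x * y + y ^ 2 + 3 * x + y = (x + y) * (x + y + 1) + x * 2 := by ring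
  rw [this, Nat.add_mul_div_right _ _ (by norm_num)]

theorem cantorPair_lt_of_add_lt {x y z w : ℕ} (h : x + y < z + w) :
    cantorPair x y < cantorPair z w := by
  rw [cantorPair_eq, cantorPair_eq]
  have h1 : (x + y + 1) * (x + y + 1 + 1) / 2 = (x + y) * (x + y + 1) / 2 + (x + y + 1) := by
    have : (x + y + 1) * (x + y + 1 + 1) = (x + y) * (x + y + 1) + (x + y + 1) * 2 := by ring
    rw [this, Nat.add_mul_div_right _ _ (by norm_num)]
  have h2 : (x + y + 1) * (x + y + 1 + 1) / 2 ≤ (z + w) * (z + w + 1) / 2 :=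
    Nat.div_le_div_right (Nat.mul_le_mul h (Nat.succ_le_succ h))
  omega

theorem cantorPair_inj {x y z w : ℕ} (h : cantorPair x y = cantorPair z w) : x = z ∧ y = w := by
  rcases lt_trichotomy (x + y) (z + w) with h' | h' | h'
  · exact absurd h (cantorPair_lt_of_add_lt h').ne
  · rw [cantorPair_eq, cantorPair_eq, h'] at h
    omega
  · exact absurd h (cantorPair_lt_of_add_lt h').ne'

theorem tupleCode_injective : ∀ n : ℕ, Function.Injective (tupleCode n)
  | 0 => fun _ _ _ => Subsingleton.elim _ _
  | 1 => fun x y h => by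
      funext i
      rw [Subsingleton.elim i 0]
      exact h
  | n + 2 => fun x y h => by
      obtain ⟨h1, h2⟩ := cantorPair_inj h
      have h3 := tupleCode_injective (n + 1) h1
      funext i
      refine Fin.lastCases h2 (fun i => ?_) i
      exact congrFun h3 i

theorem projection_tupleCode (n : ℕ) (i : Fin n) (x : Fin n → ℕ) :
    projection n i (tupleCode n x) = x i :=
  congrFun (Function.leftInverse_invFun (tupleCode_injective n) x) i

/-- The code `ζ(i)` of an integer. -/
def integerCode (i : ℤ) : ℕ := if i < 0 then (-2 * i - 1).toNat else (2 * i).toNat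

/-- The code `ρ(q)` of a rational number: if `q = ± 2 ^ e₁ * 3 ^ e₂ * 5 ^ e₃ * ⋯` then
`ρ(q) = ζ(± 2 ^ ζ(e₁) * 3 ^ ζ(e₂) * 5 ^ ζ(e₃) * ⋯)`, and `ρ(0) = 0`. -/
def rationalCode (q : ℚ) : ℕ :=
  integerCode (q.num.sign *
    ∏ p ∈ (q.num.natAbs * q.den).primeFactors, (p : ℤ) ^ integerCode (padicValRat p q))

/-- The code `⟨ρ(a), ρ(b)⟩` of the pair of endpoints of an interval. -/
def intervalCode (a b : ℚ) : ℕ := cantorPair (rationalCode a) (rationalCode b)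

/-! ### Coded bases, oracles and basic representations -/

/-- A pair `(ℬ, ν)`: a basis together with a coding of its elements by natural numbers. A number
`u` is the code of a basis element exactly if `ν u ∈ ℬ`. -/
structure CodedBasis (X : Type*) where
  basis : Set (Set X)
  coding : ℕ → Set X

namespace CodedBasis

variable {X : Type*}

/-- The domain of the coding. -/
def dom (T : CodedBasis X) : Set ℕ := {u | T.coding u ∈ T.basis}

/-- `L` is a local basis for the point `x`. -/
def IsLocalBasis (T : CodedBasis X) (x : X) (L : Set (Set X)) : Prop :=
  L ⊆ T.basis ∧ (∀ U ∈ L, x ∈ U) ∧ ∀ B ∈ T.basis, x ∈ B → ∃ U ∈ L, U ⊆ B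

/-- `φ` is an oracle for the point `x`. -/
def IsOracle (T : CodedBasis X) (φ : ℕ → ℕ) (x : X) : Prop :=
  (∀ m, φ m ∈ T.dom) ∧ T.IsLocalBasis x (T.coding '' Set.range φ)

/-- `φ` is a nested oracle for the point `x`. -/
def IsNestedOracle (T : CodedBasis X) (φ : ℕ → ℕ) (x : X) : Prop :=
  T.IsOracle φ x ∧ ∀ m, T.coding (φ (m + 1)) ⊆ T.coding (φ m)

/-- `R` is a basic representation of the set `A`. -/
def IsBasicRepresentation (T : CodedBasis X) (R : Set ℕ) (A : Set X) : Prop :=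
  R ⊆ T.dom ∧ ∀ x, x ∈ A ↔ ∃ L, T.IsLocalBasis x L ∧ L ⊆ T.coding '' R

/-- The effective product of `n` copies of `(ℬ, ν)`: the basis consists of the products
`B₁ × ⋯ × Bₙ` of basis elements, and `⟨a₁, …, aₙ⟩` is a code of `ν a₁ × ⋯ × ν aₙ`. -/
def power (T : CodedBasis X) (n : ℕ) : CodedBasis (Fin n → X) where
  basis := {B | ∃ b : Fin n → Set X, (∀ i, b i ∈ T.basis) ∧ B = Set.univ.pi b}
  coding r := {x | ∃ a : Fin n → ℕ, r = tupleCode n a ∧ ∀ i, x i ∈ T.coding (a i)}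

end CodedBasis

/-! ### Decimal intervals -/

/-- The coding `ι` of open intervals with rational endpoints. -/
def iota (u : ℕ) : Set ℝ := {x | ∃ a b : ℚ, u = intervalCode a b ∧ (a : ℝ) < x ∧ x < (b : ℝ)}

/-- The code of the decimal interval with endpoints `m / 10 ^ d - c / 10 ^ d` and
`(m + 1) / 10 ^ d + c / 10 ^ d`. -/
def decimalCode (c : ℚ) (m : ℤ) (d : ℕ) : ℕ :=
  intervalCode (m / 10 ^ d - c / 10 ^ d) ((m + 1) / 10 ^ d + c / 10 ^ d)

/-- The decimal intervals with accuracy factor `c`, with the coding `ι`. -/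
def decimalBasis (c : ℚ) : CodedBasis ℝ where
  basis := {B | ∃ (m : ℤ) (d : ℕ), 0 < d ∧ B = iota (decimalCode c m d)}
  coding := iota

/-- `u` is the code of a decimal interval with midpoint `p` and with `d` digits of precision. -/
def IsDecimalCode (c : ℚ) (u : ℕ) (p : ℝ) (d : ℕ) : Prop :=
  ∃ m : ℤ, 0 < d ∧ u = decimalCode c m d ∧ p = (m + 1 / 2) / 10 ^ d

/-- The standard decimal oracle `o_x`. -/
noncomputable def standardOracle (c : ℚ) (x : ℝ) (l : ℕ) : ℕ :=
  decimalCode c ⌊10 ^ (l + 1) * x⌋ (l + 1)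

/-- The finite part `σ` of the standard decimal oracle of `p`, defined for arguments below `d`. -/
noncomputable def truncatedOracle (c : ℚ) (p : ℝ) (d : ℕ) : ℕ →. ℕ :=
  fun l => ⟨l < d, fun _ => standardOracle c p l⟩

/-! ### Programs with oracles -/

/-- Programs for the partial recursive functionals of `k` function arguments and one number
argument. -/
inductive OracleCode (k : ℕ) : Type
  | zero : OracleCode k
  | succ : OracleCode k
  | left : OracleCode k
  | right : OracleCode k
  | oracle : Fin k → OracleCode k
  | pair : OracleCode k → OracleCode k → OracleCode k
  | comp : OracleCode k → OracleCode k → OracleCode k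
  | prec : OracleCode k → OracleCode k → OracleCode k
  | rfind : OracleCode k → OracleCode k

namespace OracleCode

variable {k : ℕ}

/-- `eval φ κ m` is the result `κ(φ₁, …, φₖ, m)` of running the program `κ` on `m` with the oracles
`φ₁, …, φₖ`. The oracles may be partial: the result is undefined if the program calls an oracle at
an argument where it is undefined. -/
def eval (φ : Fin k → ℕ →. ℕ) : OracleCode k → ℕ →. ℕ
  | zero => fun _ => Part.some 0
  | succ => fun n => Part.some (n + 1)
  | left => fun n => Part.some (Nat.unpair n).1
  | right => fun n => Part.some (Nat.unpair n).2
  | oracle i => φ i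
  | pair f g => fun n => Nat.pair <$> eval φ f n <*> eval φ g n
  | comp f g => fun n => eval φ g n >>= eval φ f
  | prec f g => fun p =>
      let (a, n) := Nat.unpair p
      n.rec (eval φ f a) fun y IH => do
        let i ← IH
        eval φ g (Nat.pair a (Nat.pair y i))
  | rfind f => fun a => Nat.rfind fun n => (fun m => decide (m = 0)) <$> eval φ f (Nat.pair a n)

/-- A numbering of the programs. -/
def toNat : OracleCode k → ℕ
  | zero => Nat.pair 0 0
  | succ => Nat.pair 1 0
  | left => Nat.pair 2 0
  | right => Nat.pair 3 0
  | oracle i => Nat.pair 4 i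
  | pair f g => Nat.pair 5 (Nat.pair f.toNat g.toNat)
  | comp f g => Nat.pair 6 (Nat.pair f.toNat g.toNat)
  | prec f g => Nat.pair 7 (Nat.pair f.toNat g.toNat)
  | rfind f => Nat.pair 8 f.toNat

theorem toNat_injective : Function.Injective (toNat (k := k)) := by
  intro f
  induction f with
  | zero | succ | left | right => intro g h; cases g <;> simp_all [toNat, Nat.pair_eq_pair]
  | oracle i =>
    intro g h
    cases g <;> simp_all [toNat, Nat.pair_eq_pair, Fin.ext_iff]
  | pair f g hf hg | comp f g hf hg | prec f g hf hg =>
    intro e h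
    cases e <;> simp [toNat, Nat.pair_eq_pair] at h ⊢
    exact ⟨hf h.1, hg h.2⟩
  | rfind f hf =>
    intro e h
    cases e <;> simp [toNat, Nat.pair_eq_pair] at h ⊢
    exact hf h

/-- The functions computed by programs with the oracles `φ` are the functions that are partial
recursive in `φ`. -/
theorem recursiveIn_iff (φ : Fin k → ℕ →. ℕ) (f : ℕ →. ℕ) :
    Nat.RecursiveIn (Set.range φ) f ↔ ∃ κ : OracleCode k, eval φ κ = f := by
  constructor
  · intro h
    induction h with
    | zero => exact ⟨zero, rfl⟩
    | succ => exact ⟨succ, rfl⟩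
    | left => exact ⟨left, rfl⟩
    | right => exact ⟨right, rfl⟩
    | oracle g hg => obtain ⟨i, rfl⟩ := hg; exact ⟨oracle i, rfl⟩
    | pair _ _ h1 h2 => obtain ⟨a, rfl⟩ := h1; obtain ⟨b, rfl⟩ := h2; exact ⟨pair a b, rfl⟩
    | comp _ _ h1 h2 => obtain ⟨a, rfl⟩ := h1; obtain ⟨b, rfl⟩ := h2; exact ⟨comp a b, rfl⟩
    | prec _ _ h1 h2 => obtain ⟨a, rfl⟩ := h1; obtain ⟨b, rfl⟩ := h2; exact ⟨prec a b, rfl⟩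
    | rfind _ h1 => obtain ⟨a, rfl⟩ := h1; exact ⟨rfind a, rfl⟩
  · rintro ⟨κ, rfl⟩
    induction κ with
    | zero => exact .zero
    | succ => exact .succ
    | left => exact .left
    | right => exact .right
    | oracle i => exact .oracle _ ⟨i, rfl⟩
    | pair f g hf hg => exact .pair hf hg
    | comp f g hf hg => exact .comp hf hg
    | prec f g hf hg => exact .prec hf hg
    | rfind f hf => exact .rfind hf

end OracleCode

/-! ### Kreisel's criterion and the representations constructed from it -/

/-- The programs `κ₁, …, κ_l` compute `ψ : ℝᵏ → ℝˡ` on nested decimal oracles: if `φ₁, …, φₖ` are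
nested oracles for `x₁, …, xₖ`, then, for each `j`, `κⱼ(φ₁, …, φₖ, m)` is defined for all `m` and is,
as a function of `m`, a nested oracle for the `j`-th coordinate of `ψ(x₁, …, xₖ)`. -/
def ComputesOnNestedOracles {k l : ℕ} (c : ℚ) (ψ : (Fin k → ℝ) → (Fin l → ℝ))
    (κ : Fin l → OracleCode k) : Prop :=
  ∀ (x : Fin k → ℝ) (φ : Fin k → ℕ → ℕ),
    (∀ i, (decimalBasis c).IsNestedOracle (φ i) (x i)) →
    ∀ j, ∃ f : ℕ → ℕ,
      (∀ m, f m ∈ (κ j).eval (fun i => (φ i : ℕ →. ℕ)) m) ∧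
      (decimalBasis c).IsNestedOracle f (ψ x j)

/-- The set `R` constructed from the programs `κ₁, …, κ_l`: it consists of all
`⟨u₁, …, uₖ, uₖ₊₁, …, uₖ₊ₗ⟩` such that each `uᵢ` with `i ≤ k` is the code of a decimal interval and
each `uₖ₊ⱼ` is a value `κⱼ(σ_{u₁}, …, σ_{uₖ}, m)` for some `m`. -/
def constructedStates {k l : ℕ} (c : ℚ) (κ : Fin l → OracleCode k) : Set ℕ :=
  {r | ∃ u : Fin (k + l) → ℕ, r = tupleCode (k + l) u ∧
    ∃ (p : Fin k → ℝ) (d : Fin k → ℕ),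
      (∀ i, IsDecimalCode c (u (Fin.castAdd l i)) (p i) (d i)) ∧
      ∀ j, ∃ m, u (Fin.natAdd k j) ∈ (κ j).eval (fun i => truncatedOracle c (p i) (d i)) m}

/-- The collection `𝒦_{k,n,c}`, for `n = k + l`, of all pairs `(R, H)` constructed from functions
`ψ : ℝᵏ → ℝˡ` that satisfy Kreisel's criterion; `H` is the set of projection functions. -/
def kreiselRepresentations (k l : ℕ) (c : ℚ) : Set (Set ℕ × Set (ℕ → ℕ)) :=
  {M | ∃ (ψ : (Fin k → ℝ) → (Fin l → ℝ)) (κ : Fin l → OracleCode k),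
    ComputesOnNestedOracles c ψ κ ∧
    M = (constructedStates c κ, Set.range (projection (k + l)))}

/-- The graph of `ψ : ℝᵏ → ℝˡ`, as a subset of `ℝᵏ⁺ˡ`. -/
def graphSet {k l : ℕ} (ψ : (Fin k → ℝ) → (Fin l → ℝ)) : Set (Fin (k + l) → ℝ) :=
  {y | ψ (fun i => y (Fin.castAdd l i)) = fun j => y (Fin.natAdd k j)}

/-! ### Computable physical models -/

/-- `(T, B)` is a computable physical model: `T` is a recursive set and the members of `B` are total
recursive functions. -/
def IsComputableModel (T : Set ℕ) (B : Set (ℕ → ℕ)) : Prop :=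
  ComputablePred (fun s => s ∈ T) ∧ ∀ β ∈ B, Computable β

/-- `(f, g)` is an isomorphism from the physical model `(S, A)` to the physical model `(T, B)`. -/
def IsModelIso (S : Set ℕ) (A : Set (ℕ → ℕ)) (T : Set ℕ) (B : Set (ℕ → ℕ))
    (f : ℕ → ℕ) (g : (ℕ → ℕ) → (ℕ → ℕ)) : Prop :=
  Set.BijOn f S T ∧ Set.BijOn g A B ∧ ∀ s ∈ S, ∀ α ∈ A, α s = g α (f s)

/-- The program `t` decides membership in `T`. -/
def Decides (t : Nat.Partrec.Code) (T : Set ℕ) : Prop :=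
  ∀ s, (s ∈ T → t.eval s = Part.some 1) ∧ (s ∉ T → t.eval s = Part.some 0)

/-- The program `e` semi-decides membership in `R`: it halts exactly on the members of `R`. -/
def SemiDecides (e : Nat.Partrec.Code) (R : Set ℕ) : Prop :=
  ∀ r, (e.eval r).Dom ↔ r ∈ R

/-!
The inputs of a box in `R` determine its outputs only through the truncated oracles, and a truncated
oracle for an interval extends to a nested oracle for each point of the interval. Hence, if the
inputs of a box in `R` contain `x`, the outputs contain `ψ x`. Conversely, because `R` is a
representation of the graph, the boxes in `R` around `(x, ψ x)` are arbitrarily small. A predictor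
therefore searches for a box that is accepted by the program for `R`, whose inputs include the
current values of the oracles, and whose outputs improve on the previous prediction.

A recursively enumerable `R` is isomorphic to a model on a recursive set, in which a state is a
member of `R` together with the first running time that suffices to accept it. Conversely, in any
model `(T, {β₁, …, βₙ})` isomorphic to `(R, H)` the members of `R` are the `⟨β₁(s), …, βₙ(s)⟩` for
`s ∈ T`, which makes `R` recursively enumerable from the programs for the model.
-/

open UniqueFactorizationMonoid (radical)
open Encodable (encode)
open Nat.Partrec (Code)

section RationalCodes

theorem factorization_prod_pow {s : Finset ℕ} (hs : ∀ p ∈ s, p.Prime) (f : ℕ → ℕ) (p : ℕ) :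
    (∏ q ∈ s, q ^ f q).factorization p = if p ∈ s then f p else 0 := by
  rw [Nat.factorization_prod fun q hq => pow_ne_zero _ (hs q hq).ne_zero, Finset.sum_apply']
  rw [Finset.sum_congr rfl fun q hq => by rw [(hs q hq).factorization_pow, Finsupp.single_apply],
    Finset.sum_ite_eq']

theorem factorization_radical {n p : ℕ} :
    (radical n).factorization p = if p ∈ n.primeFactors then 1 else 0 := by
  rw [Nat.radical_eq_prod_primeFactors,
    ← factorization_prod_pow (fun _ => Nat.prime_of_mem_primeFactors) fun _ => 1]
  simp only [pow_one]

theorem eq_of_prime_factorization_eq {a b : ℕ} (ha : a ≠ 0) (hb : b ≠ 0)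
    (h : ∀ p, p.Prime → a.factorization p = b.factorization p) : a = b :=
  (Nat.eq_iff_prime_padicValNat_eq a b ha hb).2 fun p hp => by
    simpa only [Nat.factorization_def _ hp] using h p hp

theorem integerCode_injective : Function.Injective integerCode := by
  intro i j h
  unfold integerCode at h
  split_ifs at h <;> omega

theorem integerCode_natCast (n : ℕ) : integerCode n = 2 * n := by
  unfold integerCode
  split_ifs <;> omega

theorem integerCode_neg {i : ℤ} (hi : 0 ≤ i) : integerCode (-i) = integerCode i - 1 := by
  unfold integerCode
  split_ifs <;> omega

theorem factorization_num_and_den {p : ℕ} (hp : p.Prime) (q : ℚ) :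
    q.num.natAbs.factorization p = (padicValRat p q).toNat ∧
      q.den.factorization p = (-padicValRat p q).toNat := by
  have coprime_factorization : q.num.natAbs.factorization p = 0 ∨ q.den.factorization p = 0 := by
    by_contra! h
    exact hp.not_dvd_one (q.reduced ▸ Nat.dvd_gcd (Nat.dvd_of_factorization_pos h.1)
      (Nat.dvd_of_factorization_pos h.2))
  have padicValRat_eq : padicValRat p q = q.num.natAbs.factorization p - q.den.factorization p := by
    rw [padicValRat, padicValInt, Nat.factorization_def _ hp, Nat.factorization_def _ hp]
  omega

/-- The natural number `∏ₚ p ^ ζ(eₚ)` for `q = ± ∏ₚ p ^ eₚ`, whose product with the sign of `q` is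
coded by `ρ(q)`. -/
def magnitudeCode (q : ℚ) : ℕ :=
  ∏ p ∈ (q.num.natAbs * q.den).primeFactors, p ^ integerCode (padicValRat p q)

theorem rationalCode_eq (q : ℚ) : rationalCode q = integerCode (q.num.sign * magnitudeCode q) := by
  simp only [rationalCode, magnitudeCode, Nat.cast_prod, Nat.cast_pow]

theorem magnitudeCode_pos (q : ℚ) : 0 < magnitudeCode q :=
  Finset.prod_pos fun _ hp => pow_pos (Nat.prime_of_mem_primeFactors hp).pos _

theorem factorization_magnitudeCode {q : ℚ} (hq : q ≠ 0) {p : ℕ} (hp : p.Prime) :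
    (magnitudeCode q).factorization p = integerCode (padicValRat p q) := by
  rw [magnitudeCode, factorization_prod_pow (fun _ => Nat.prime_of_mem_primeFactors)
    fun p => integerCode (padicValRat p q)]
  split_ifs with h
  · rfl
  have hprod : (q.num.natAbs * q.den).factorization p = 0 :=
    Finsupp.notMem_support_iff.1 (by rwa [Nat.support_factorization])
  rw [Nat.factorization_mul (by simpa using hq) q.den_nz, Finsupp.add_apply] at hprod
  obtain ⟨hnum, hden⟩ := factorization_num_and_den hp q
  rw [show padicValRat p q = (0 : ℕ) by omega, integerCode_natCast]

theorem eq_of_sign_eq_of_padicValRat_eq {q r : ℚ} (hq : q ≠ 0) (hr : r ≠ 0)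
    (hsign : q.num.sign = r.num.sign)
    (hval : ∀ p : ℕ, p.Prime → padicValRat p q = padicValRat p r) : q = r := by
  have hnum : q.num.natAbs = r.num.natAbs :=
    eq_of_prime_factorization_eq (by simpa using hq) (by simpa using hr) fun p hp => by
      rw [(factorization_num_and_den hp q).1, (factorization_num_and_den hp r).1, hval p hp]
  have hden : q.den = r.den := eq_of_prime_factorization_eq q.den_nz r.den_nz fun p hp => by
    rw [(factorization_num_and_den hp q).2, (factorization_num_and_den hp r).2, hval p hp]
  exact Rat.ext (by rw [← Int.sign_mul_natAbs q.num, ← Int.sign_mul_natAbs r.num, hsign, hnum]) hden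

theorem rationalCode_injective : Function.Injective rationalCode := by
  intro q r h
  have hcode : q.num.sign * magnitudeCode q = r.num.sign * magnitudeCode r :=
    integerCode_injective (by rw [← rationalCode_eq, ← rationalCode_eq, h])
  have sign_code (s : ℚ) : (s.num.sign * magnitudeCode s).sign = s.num.sign := by
    rw [Int.sign_mul, Int.sign_sign, Int.sign_natCast_of_ne_zero (magnitudeCode_pos s).ne', mul_one]
  have hsign : q.num.sign = r.num.sign := by rw [← sign_code q, hcode, sign_code r]
  have eq_zero_iff : q = 0 ↔ r = 0 := by
    rw [← Rat.num_eq_zero, ← Rat.num_eq_zero, ← Int.sign_eq_zero_iff_zero, hsign,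
      Int.sign_eq_zero_iff_zero]
  rcases eq_or_ne q 0 with hq | hq
  · rw [hq, eq_zero_iff.1 hq]
  have hr : r ≠ 0 := mt eq_zero_iff.2 hq
  have hmagnitude : magnitudeCode q = magnitudeCode r := by
    rw [hsign] at hcode
    exact Int.ofNat_injective
      (mul_left_cancel₀ (by simpa [Int.sign_eq_zero_iff_zero] using hr) hcode)
  exact eq_of_sign_eq_of_padicValRat_eq hq hr hsign fun p hp => integerCode_injective (by
    rw [← factorization_magnitudeCode hq hp, hmagnitude, factorization_magnitudeCode hr hp])

theorem iota_intervalCode (a b : ℚ) : iota (intervalCode a b) = Set.Ioo (a : ℝ) b := by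
  ext x
  constructor
  · rintro ⟨a', b', h, h1, h2⟩
    obtain ⟨ha, hb⟩ := cantorPair_inj h
    rw [rationalCode_injective ha, rationalCode_injective hb]
    exact ⟨h1, h2⟩
  · rintro ⟨h1, h2⟩
    exact ⟨a, b, rfl, h1, h2⟩

theorem magnitudeCode_mul_radical_den {q : ℚ} (hq : q ≠ 0) :
    magnitudeCode q * radical q.den = (q.num.natAbs * q.den) ^ 2 := by
  have hnum : q.num.natAbs ≠ 0 := by simpa using hq
  refine eq_of_prime_factorization_eq
    (mul_ne_zero (magnitudeCode_pos q).ne' (Nat.radical_pos _).ne')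
    (pow_ne_zero 2 (mul_ne_zero hnum q.den_nz)) fun p hp => ?_
  rw [Nat.factorization_mul (magnitudeCode_pos q).ne' (Nat.radical_pos _).ne',
    Nat.factorization_pow, Nat.factorization_mul hnum q.den_nz]
  simp only [Finsupp.add_apply, Finsupp.smul_apply, smul_eq_mul, factorization_radical,
    factorization_magnitudeCode hq hp, ← Nat.support_factorization, Finsupp.mem_support_iff,
    factorization_num_and_den hp q]
  unfold integerCode
  split_ifs <;> omega

theorem rationalCode_of_nonneg {q : ℚ} (hq : 0 ≤ q) :
    rationalCode q = 2 * ((q.num.natAbs * q.den) ^ 2 / radical q.den) := by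
  rcases hq.eq_or_lt with rfl | hpos
  · simp [rationalCode_eq, integerCode]
  rw [rationalCode_eq, Int.sign_eq_one_of_pos (Rat.num_pos.2 hpos), one_mul, integerCode_natCast,
    ← magnitudeCode_mul_radical_den hpos.ne', Nat.mul_div_cancel _ (Nat.radical_pos _)]

theorem magnitudeCode_neg (q : ℚ) : magnitudeCode (-q) = magnitudeCode q := by
  simp only [magnitudeCode, Rat.num_neg_eq_neg_num, Int.natAbs_neg, Rat.den_neg_eq_den,
    padicValRat.neg]

theorem rationalCode_neg {q : ℚ} (hq : 0 ≤ q) : rationalCode (-q) = rationalCode q - 1 := by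
  rw [rationalCode_eq, rationalCode_eq, magnitudeCode_neg, Rat.num_neg_eq_neg_num, Int.sign_neg,
    neg_mul, integerCode_neg]
  exact mul_nonneg (Int.sign_nonneg_iff.2 (Rat.num_nonneg.2 hq)) (Nat.cast_nonneg _)

theorem rationalCode_natCast_div (a b : ℕ) :
    rationalCode ((a : ℚ) / b) =
      2 * ((a / a.gcd b * (b / a.gcd b)) ^ 2 / radical (b / a.gcd b)) := by
  rcases Nat.eq_zero_or_pos b with rfl | hb
  · simp [rationalCode_of_nonneg]
  have hg : 0 < a.gcd b := Nat.gcd_pos_of_pos_right a hb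
  have hcoprime : Nat.Coprime ((a / a.gcd b : ℕ) : ℤ).natAbs ((b / a.gcd b : ℕ) : ℤ).natAbs :=
    Nat.coprime_div_gcd_div_gcd hg
  have hden : (0 : ℤ) < (b / a.gcd b : ℕ) :=
    Int.natCast_pos.2 (Nat.div_pos (Nat.gcd_le_right a hb) hg)
  have hlowest : (a : ℚ) / b = ((a / a.gcd b : ℕ) : ℤ) / ((b / a.gcd b : ℕ) : ℤ) := by
    have hg' : (a.gcd b : ℚ) ≠ 0 := by positivity
    rw [Int.cast_natCast, Int.cast_natCast, Nat.cast_div (Nat.gcd_dvd_left a b) hg',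
      Nat.cast_div (Nat.gcd_dvd_right a b) hg', div_div_div_cancel_right₀ hg']
  have hnum' := Rat.num_div_eq_of_coprime hden hcoprime
  have hden' := Rat.den_div_eq_of_coprime hden hcoprime
  rw [rationalCode_of_nonneg (by positivity), hlowest, hnum', Int.natAbs_natCast,
    Int.natCast_inj.1 hden']

end RationalCodes

section PrimrecArithmetic

theorem primrec_pow : Primrec₂ ((· ^ ·) : ℕ → ℕ → ℕ) :=
  Primrec₂.unpaired'.1 Nat.Primrec.pow

theorem primrecRel_dvd : PrimrecRel ((· ∣ ·) : ℕ → ℕ → Prop) :=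
  (Primrec.eq.comp (Primrec.nat_mod.comp Primrec.snd Primrec.fst) (Primrec.const 0)).of_eq
    fun _ => Nat.dvd_iff_mod_eq_zero.symm

theorem gcd_eq_findGreatest (a b : ℕ) :
    a.gcd b = Nat.findGreatest (fun d => d ∣ a ∧ d ∣ b) (a + b) := by
  symm
  rw [Nat.findGreatest_eq_iff]
  refine ⟨?_, fun _ => ⟨Nat.gcd_dvd_left a b, Nat.gcd_dvd_right a b⟩, fun d hgt hle hd => ?_⟩
  · rcases Nat.eq_zero_or_pos a with rfl | ha
    · simp
    · exact (Nat.gcd_le_left b ha).trans (Nat.le_add_right a b)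
  · have hpos : 0 < a.gcd b := by
      rw [Nat.gcd_pos_iff]
      omega
    exact hgt.not_ge (Nat.le_of_dvd hpos (Nat.dvd_gcd hd.1 hd.2))

theorem primrec_gcd : Primrec₂ Nat.gcd :=
  (Primrec.nat_findGreatest (Primrec.nat_add.comp Primrec.fst Primrec.snd)
    ((primrecRel_dvd.comp Primrec.snd (Primrec.fst.comp Primrec.fst)).and
      (primrecRel_dvd.comp Primrec.snd (Primrec.snd.comp Primrec.fst))).primrecRel).of_eq
    fun p => (gcd_eq_findGreatest p.1 p.2).symm

theorem squarefree_iff_forall_lt_succ (n : ℕ) :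
    Squarefree n ↔ ∀ d < n + 1, d * d ∣ n → d = 1 := by
  simp only [Squarefree, Nat.isUnit_iff]
  refine ⟨fun h d _ => h d, fun h d hd => h d ?_ hd⟩
  rcases Nat.eq_zero_or_pos n with rfl | hn
  · exact absurd (h 0 (Nat.lt_succ_self 0) (dvd_zero _)) zero_ne_one
  · exact Nat.lt_succ_of_le (Nat.le_of_dvd hn (dvd_of_mul_left_dvd hd))

theorem primrecPred_squarefree : PrimrecPred (Squarefree : ℕ → Prop) := by
  have hR : PrimrecRel fun d n : ℕ => d * d ∣ n → d = 1 :=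
    ((primrecRel_dvd.comp (Primrec.nat_mul.comp Primrec.fst Primrec.fst) Primrec.snd).not.or
      (Primrec.eq.comp Primrec.fst (Primrec.const 1))).of_eq fun _ => imp_iff_not_or.symm
  exact (hR.forall_lt.comp Primrec.succ Primrec.id).of_eq
    fun n => (squarefree_iff_forall_lt_succ n).symm

open Classical in
theorem radical_eq_findGreatest (n : ℕ) :
    radical n = Nat.findGreatest (fun d => d ∣ n ∧ Squarefree d) (n + 1) := by
  symm
  rw [Nat.findGreatest_eq_iff]
  refine ⟨?_, fun _ => ⟨UniqueFactorizationMonoid.radical_dvd_self,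
    UniqueFactorizationMonoid.squarefree_radical⟩, fun d hgt hle hd => hgt.not_ge ?_⟩
  · rcases eq_or_ne n 0 with rfl | hn
    · simp
    · exact (Nat.radical_le_self_iff.2 hn).trans n.le_succ
  · rcases eq_or_ne n 0 with rfl | hn
    · simpa using hle
    · exact Nat.le_of_dvd (Nat.radical_pos n)
        ((UniqueFactorizationMonoid.dvd_radical_iff hd.2.isRadical hn).2 hd.1)

open Classical in
theorem primrec_radical : Primrec (radical : ℕ → ℕ) :=
  (Primrec.nat_findGreatest Primrec.succ
    ((primrecRel_dvd.comp Primrec.snd Primrec.fst).and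
      (primrecPred_squarefree.comp Primrec.snd)).primrecRel).of_eq
    fun n => (radical_eq_findGreatest n).symm

theorem primrec_rationalCode_natCast_div :
    Primrec₂ fun a b : ℕ => rationalCode ((a : ℚ) / b) := by
  have hnum : Primrec₂ fun a b : ℕ => a / a.gcd b := Primrec.nat_div.comp Primrec.fst primrec_gcd
  have hden : Primrec₂ fun a b : ℕ => b / a.gcd b := Primrec.nat_div.comp Primrec.snd primrec_gcd
  exact (Primrec.nat_mul.comp (Primrec.const 2) (Primrec.nat_div.comp
    (primrec_pow.comp (Primrec.nat_mul.comp hnum hden) (Primrec.const 2))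
    (primrec_radical.comp hden))).of_eq fun p => (rationalCode_natCast_div p.1 p.2).symm

theorem encode_intCast (n : ℕ) : Encodable.encode (n : ℤ) = 2 * n := rfl

theorem encode_int_negSucc (n : ℕ) : Encodable.encode (Int.negSucc n) = 2 * n + 1 := rfl

theorem primrec_int_natCast : Primrec ((↑) : ℕ → ℤ) :=
  Primrec.encode_iff.1 (Primrec.nat_mul.comp (Primrec.const 2) Primrec.id)

theorem primrec_int_toNat : Primrec Int.toNat := by
  refine (Primrec.ite (Primrec.eq.comp (Primrec.nat_mod.comp Primrec.encode (Primrec.const 2))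
    (Primrec.const 0)) (Primrec.nat_div.comp Primrec.encode (Primrec.const 2))
    (Primrec.const 0)).of_eq fun i => ?_
  rcases i with n | n
  · rw [Int.ofNat_eq_natCast, encode_intCast]
    split_ifs <;> omega
  · rw [encode_int_negSucc]
    split_ifs <;> omega

theorem primrec_int_toNat_neg : Primrec fun i : ℤ => (-i).toNat := by
  refine (Primrec.ite (Primrec.eq.comp (Primrec.nat_mod.comp Primrec.encode (Primrec.const 2))
    (Primrec.const 0)) (Primrec.const 0)
    (Primrec.succ.comp (Primrec.nat_div.comp Primrec.encode (Primrec.const 2)))).of_eq fun i => ?_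
  rcases i with n | n
  · rw [Int.ofNat_eq_natCast, encode_intCast]
    split_ifs <;> omega
  · rw [encode_int_negSucc]
    split_ifs <;> omega

theorem primrec_int_natCast_sub : Primrec₂ fun a b : ℕ => (a : ℤ) - b := by
  refine Primrec.encode_iff.1 ((Primrec.ite (Primrec.nat_le.comp Primrec.snd Primrec.fst)
    (Primrec.nat_mul.comp (Primrec.const 2) (Primrec.nat_sub.comp Primrec.fst Primrec.snd))
    (Primrec.nat_sub.comp (Primrec.nat_mul.comp (Primrec.const 2)
      (Primrec.nat_sub.comp Primrec.snd Primrec.fst)) (Primrec.const 1))).of_eq fun p => ?_)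
  beta_reduce
  split_ifs with h
  · rw [show (p.1 : ℤ) - p.2 = (p.1 - p.2 : ℕ) by omega, encode_intCast]
  · rw [show (p.1 : ℤ) - p.2 = Int.negSucc (p.2 - p.1 - 1) by omega, encode_int_negSucc]
    omega

theorem primrec_int_add : Primrec₂ ((· + ·) : ℤ → ℤ → ℤ) := by
  have hpos {i : ℤ × ℤ → ℤ} (hi : Primrec i) := primrec_int_toNat.comp hi
  have hneg {i : ℤ × ℤ → ℤ} (hi : Primrec i) := primrec_int_toNat_neg.comp hi
  refine (primrec_int_natCast_sub.comp
    (Primrec.nat_add.comp (hpos Primrec.fst) (hpos Primrec.snd))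
    (Primrec.nat_add.comp (hneg Primrec.fst) (hneg Primrec.snd))).of_eq fun p => ?_
  beta_reduce
  omega

theorem primrec_int_mul : Primrec₂ ((· * ·) : ℤ → ℤ → ℤ) := by
  have hpos {i : ℤ × ℤ → ℤ} (hi : Primrec i) := primrec_int_toNat.comp hi
  have hneg {i : ℤ × ℤ → ℤ} (hi : Primrec i) := primrec_int_toNat_neg.comp hi
  refine (primrec_int_natCast_sub.comp
    (Primrec.nat_add.comp (Primrec.nat_mul.comp (hpos Primrec.fst) (hpos Primrec.snd))
      (Primrec.nat_mul.comp (hneg Primrec.fst) (hneg Primrec.snd)))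
    (Primrec.nat_add.comp (Primrec.nat_mul.comp (hpos Primrec.fst) (hneg Primrec.snd))
      (Primrec.nat_mul.comp (hneg Primrec.fst) (hpos Primrec.snd)))).of_eq fun p => ?_
  conv_rhs => rw [← Int.toNat_sub_toNat_neg p.1, ← Int.toNat_sub_toNat_neg p.2]
  push_cast
  ring

theorem primrecRel_int_le : PrimrecRel ((· ≤ ·) : ℤ → ℤ → Prop) := by
  refine (Primrec.nat_le.comp
    (Primrec.nat_add.comp (primrec_int_toNat.comp Primrec.fst)
      (primrec_int_toNat_neg.comp Primrec.snd))
    (Primrec.nat_add.comp (primrec_int_toNat.comp Primrec.snd)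
      (primrec_int_toNat_neg.comp Primrec.fst))).of_eq fun p => ?_
  omega

theorem int_ediv_natCast (i : ℤ) (n : ℕ) :
    i / n = ((i.toNat / n : ℕ) : ℤ) - (((-i).toNat + n - 1) / n : ℕ) := by
  rcases Nat.eq_zero_or_pos n with rfl | hn
  · simp
  rcases i with a | a
  · simp [Nat.div_eq_of_lt (Nat.sub_lt hn one_pos)]
  · rw [Int.negSucc_ediv _ (by omega), Int.toNat_negSucc,
      show (-Int.negSucc a).toNat + n - 1 = a + n by omega, Nat.add_div_right _ hn,
      Nat.zero_div, Nat.cast_zero, zero_sub]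
    rfl

theorem primrec_int_ediv_natCast : Primrec₂ fun (i : ℤ) (n : ℕ) => i / (n : ℤ) :=
  (primrec_int_natCast_sub.comp
    (Primrec.nat_div.comp (primrec_int_toNat.comp Primrec.fst) Primrec.snd)
    (Primrec.nat_div.comp (Primrec.nat_sub.comp (Primrec.nat_add.comp
      (primrec_int_toNat_neg.comp Primrec.fst) Primrec.snd) (Primrec.const 1)) Primrec.snd)).of_eq
    fun p => (int_ediv_natCast p.1 p.2).symm

theorem primrec_rationalCode_intCast_div :
    Primrec₂ fun (i : ℤ) (b : ℕ) => rationalCode ((i : ℚ) / b) := by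
  refine (Primrec.ite (primrecRel_int_le.comp (Primrec.const 0) Primrec.fst)
    (primrec_rationalCode_natCast_div.comp (primrec_int_toNat.comp Primrec.fst) Primrec.snd)
    (Primrec.nat_sub.comp (primrec_rationalCode_natCast_div.comp
      (primrec_int_toNat_neg.comp Primrec.fst) Primrec.snd) (Primrec.const 1))).of_eq fun p => ?_
  split_ifs with h
  · rw [← Int.cast_natCast, Int.toNat_of_nonneg h]
  · rw [← rationalCode_neg (by positivity), ← neg_div, ← Int.cast_natCast (-p.1).toNat,
      Int.toNat_of_nonneg (by omega), Int.cast_neg, neg_neg]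

theorem primrec_cantorPair : Primrec₂ cantorPair := by
  have hsum : Primrec₂ fun x y : ℕ => x + y := Primrec.nat_add
  exact (Primrec.nat_add.comp (Primrec.nat_div.comp (Primrec.nat_mul.comp hsum
    (Primrec.succ.comp hsum)) (Primrec.const 2)) Primrec.fst).of_eq
    fun p => (cantorPair_eq p.1 p.2).symm

theorem primrec_tupleCode : ∀ n, Primrec (tupleCode n)
  | 0 => Primrec.const 0
  | 1 => Primrec.fin_app.comp Primrec.id (Primrec.const 0)
  | n + 2 => primrec_cantorPair.comp
      ((primrec_tupleCode (n + 1)).comp (Primrec.fin_curry.2 (Primrec.fin_app.comp Primrec.fst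
        ((Primrec.dom_finite Fin.castSucc).comp Primrec.snd))))
      (Primrec.fin_app.comp Primrec.id (Primrec.const (Fin.last (n + 1))))

theorem primrecPred_forall_fin {α : Type*} [Primcodable α] :
    ∀ {n : ℕ} {p : Fin n → α → Prop}, (∀ i, PrimrecPred (p i)) → PrimrecPred fun a => ∀ i, p i a
  | 0, _, _ => (Primrec.eq.comp (Primrec.const 0) (Primrec.const 0)).of_eq fun _ => by simp
  | _ + 1, _, hp => ((hp 0).and (primrecPred_forall_fin fun i => hp i.succ)).of_eq
      fun _ => by simp only [Fin.forall_fin_succ]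

end PrimrecArithmetic

section DecimalIntervals

/-- The decimal interval with accuracy factor `c` that is given by the pair `z = (m, d)`. -/
def decimalInterval (c : ℚ) (z : ℤ × ℕ) : Set ℝ :=
  Set.Ioo (((z.1 - c) / 10 ^ z.2 : ℝ)) (((z.1 + 1 + c) / 10 ^ z.2 : ℝ))

theorem iota_decimalCode (c : ℚ) (z : ℤ × ℕ) :
    iota (decimalCode c z.1 z.2) = decimalInterval c z := by
  rw [decimalCode, iota_intervalCode, decimalInterval]
  push_cast
  rw [sub_div, add_div _ (c : ℝ)]

theorem decimalInterval_lower_lt_upper {c : ℚ} (hc : 0 < c) (z : ℤ × ℕ) :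
    ((z.1 - c) / 10 ^ z.2 : ℝ) < (z.1 + 1 + c) / 10 ^ z.2 := by
  have hc' : (0 : ℝ) < c := Rat.cast_pos.2 hc
  gcongr
  linarith

theorem mem_dom_decimalBasis_iff {c : ℚ} (hc : 0 < c) {u : ℕ} :
    u ∈ (decimalBasis c).dom ↔ ∃ z : ℤ × ℕ, 0 < z.2 ∧ u = decimalCode c z.1 z.2 := by
  constructor
  · rintro ⟨m, d, hd, hu : iota u = iota (decimalCode c m d)⟩
    rw [iota_decimalCode c (m, d)] at hu
    have hlt := decimalInterval_lower_lt_upper hc (m, d)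
    obtain ⟨x, hx⟩ : (iota u).Nonempty := hu ▸ Set.nonempty_Ioo.2 hlt
    obtain ⟨a, b, rfl, hax, hxb⟩ := hx
    rw [iota_intervalCode, decimalInterval] at hu
    have ha := congrArg sInf hu
    have hb := congrArg sSup hu
    rw [csInf_Ioo (hax.trans hxb), csInf_Ioo hlt] at ha
    rw [csSup_Ioo (hax.trans hxb), csSup_Ioo hlt] at hb
    refine ⟨(m, d), hd, ?_⟩
    rw [decimalCode, ← sub_div, ← add_div]
    congr 1
    · exact_mod_cast ha
    · exact_mod_cast hb
  · rintro ⟨z, hz, rfl⟩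
    exact ⟨z.1, z.2, hz, rfl⟩

theorem exists_decimalInterval_subset_Ioo (c : ℚ) {x a b : ℝ} (ha : a < x) (hb : x < b) :
    ∃ N : ℕ, ∀ z : ℤ × ℕ, N ≤ z.2 → x ∈ decimalInterval c z →
      decimalInterval c z ⊆ Set.Ioo a b := by
  have hε : 0 < min (x - a) (b - x) := lt_min (sub_pos.2 ha) (sub_pos.2 hb)
  obtain ⟨N, hN⟩ := pow_unbounded_of_one_lt ((1 + 2 * (c : ℝ)) / min (x - a) (b - x))
    (by norm_num : (1 : ℝ) < 10)
  refine ⟨N, fun z hz hx => ?_⟩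
  have hlength : ((z.1 + 1 + c) / 10 ^ z.2 : ℝ) - (z.1 - c) / 10 ^ z.2 < min (x - a) (b - x) := by
    have hpow : (10 : ℝ) ^ N ≤ 10 ^ z.2 := pow_le_pow_right₀ (by norm_num) hz
    rw [← sub_div, div_lt_iff₀ (by positivity)]
    rw [div_lt_iff₀' hε] at hN
    linarith [mul_le_mul_of_nonneg_left hpow hε.le]
  rw [lt_min_iff] at hlength
  exact Set.Ioo_subset_Ioo (by linarith [hx.2]) (by linarith [hx.1])

theorem snd_le_snd_of_decimalInterval_subset {c : ℚ} (hc : 0 < c) {z w : ℤ × ℕ}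
    (h : decimalInterval c z ⊆ decimalInterval c w) : w.2 ≤ z.2 := by
  obtain ⟨hlower, hupper⟩ := (Set.Ioo_subset_Ioo_iff (decimalInterval_lower_lt_upper hc z)).1 h
  have hlength : ((1 + 2 * c) / 10 ^ z.2 : ℝ) ≤ (1 + 2 * c) / 10 ^ w.2 := by
    calc ((1 + 2 * c) / 10 ^ z.2 : ℝ) = (z.1 + 1 + c) / 10 ^ z.2 - (z.1 - c) / 10 ^ z.2 := by ring
      _ ≤ (w.1 + 1 + c) / 10 ^ w.2 - (w.1 - c) / 10 ^ w.2 := sub_le_sub hupper hlower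
      _ = (1 + 2 * c) / 10 ^ w.2 := by ring
  have hc' : (0 : ℝ) < 1 + 2 * c := by positivity
  rw [div_le_div_iff_of_pos_left hc' (by positivity) (by positivity)] at hlength
  exact (pow_le_pow_iff_right₀ (by norm_num)).1 hlength

theorem isNestedOracle_decimalCode {c : ℚ} {z : ℕ → ℤ × ℕ} {x : ℝ} (hpos : ∀ m, 0 < (z m).2)
    (hmem : ∀ m, x ∈ decimalInterval c (z m))
    (hnested : ∀ m, decimalInterval c (z (m + 1)) ⊆ decimalInterval c (z m))
    (hprecise : ∀ N, ∃ m, N ≤ (z m).2) :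
    (decimalBasis c).IsNestedOracle (fun m => decimalCode c (z m).1 (z m).2) x := by
  have coding_eq (m : ℕ) : (decimalBasis c).coding (decimalCode c (z m).1 (z m).2) =
      decimalInterval c (z m) := iota_decimalCode c (z m)
  refine ⟨⟨fun m => ⟨_, _, hpos m, rfl⟩, ?_, ?_, ?_⟩, fun m => ?_⟩
  · rintro _ ⟨_, ⟨m, rfl⟩, rfl⟩
    exact ⟨_, _, hpos m, rfl⟩
  · rintro _ ⟨_, ⟨m, rfl⟩, rfl⟩
    exact (coding_eq m).symm ▸ hmem m
  · rintro _ ⟨m, d, -, rfl⟩ hx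
    rw [iota_decimalCode c (m, d)] at hx ⊢
    obtain ⟨N, hN⟩ := exists_decimalInterval_subset_Ioo c hx.1 hx.2
    obtain ⟨j, hj⟩ := hprecise N
    exact ⟨_, ⟨_, ⟨j, rfl⟩, coding_eq j⟩, hN _ hj (hmem j)⟩
  · rw [coding_eq, coding_eq]
    exact hnested m

/-- The pair `(m, d)` of the decimal interval with `d` digits that the standard decimal oracle
chooses around `x`. -/
noncomputable def decimalApprox (x : ℝ) (d : ℕ) : ℤ × ℕ := (⌊10 ^ d * x⌋, d)

theorem mem_decimalInterval_decimalApprox {c : ℚ} (hc : 0 < c) (x : ℝ) (d : ℕ) :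
    x ∈ decimalInterval c (decimalApprox x d) := by
  have hc' : (0 : ℝ) < c := Rat.cast_pos.2 hc
  rw [decimalInterval, decimalApprox, Set.mem_Ioo, div_lt_iff₀ (by positivity),
    lt_div_iff₀ (by positivity)]
  have hfloor_le := Int.floor_le (10 ^ d * x)
  have hlt_floor := Int.lt_floor_add_one (10 ^ d * x)
  constructor <;> linarith

theorem antitone_decimalInterval_decimalApprox {c : ℚ} (hc : 0 < c) (x : ℝ) :
    Antitone fun d => decimalInterval c (decimalApprox x d) := by
  refine antitone_nat_of_succ_le fun d => ?_
  have hc' : (0 : ℝ) < c := Rat.cast_pos.2 hc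
  have hpow : (10 : ℝ) ^ (d + 1) * x = 10 * (10 ^ d * x) := by ring
  simp only [decimalInterval, decimalApprox, hpow]
  have hlower : (10 : ℝ) * ⌊10 ^ d * x⌋ ≤ ⌊10 * (10 ^ d * x)⌋ := by
    have : 10 * ⌊10 ^ d * x⌋ ≤ ⌊10 * (10 ^ d * x)⌋ := by
      rw [Int.le_floor]
      push_cast
      linarith [Int.floor_le (10 ^ d * x)]
    exact_mod_cast this
  have hupper : (⌊10 * (10 ^ d * x)⌋ : ℝ) + 1 ≤ 10 * (⌊10 ^ d * x⌋ + 1) := by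
    have : ⌊10 * (10 ^ d * x)⌋ + 1 ≤ 10 * (⌊10 ^ d * x⌋ + 1) := by
      rw [Int.add_one_le_iff, Int.floor_lt]
      push_cast
      linarith [Int.lt_floor_add_one (10 ^ d * x)]
    exact_mod_cast this
  have hscale (r : ℝ) : r / 10 ^ d = 10 * r / 10 ^ (d + 1) := by
    rw [pow_succ', mul_div_mul_left _ _ (by norm_num)]
  rw [hscale, hscale]
  apply Set.Ioo_subset_Ioo <;> apply div_le_div_of_nonneg_right _ (by positivity) <;> linarith

theorem decimalApprox_midpoint (m : ℤ) {l d : ℕ} (hl : l ≤ d) :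
    decimalApprox ((m + 1 / 2) / 10 ^ d) l = (m / 10 ^ (d - l), l) := by
  obtain ⟨e, rfl⟩ := Nat.exists_eq_add_of_le hl
  rw [decimalApprox, Nat.add_sub_cancel_left, Prod.mk.injEq, Int.floor_eq_iff, pow_add]
  have hcancel : (10 : ℝ) ^ l * ((m + 1 / 2) / (10 ^ l * 10 ^ e)) = (m + 1 / 2) / 10 ^ e := by
    field_simp
  have hpow : (0 : ℤ) < 10 ^ e := by positivity
  have hlower : ((m / 10 ^ e : ℤ) : ℝ) * 10 ^ e ≤ m := by
    exact_mod_cast Int.ediv_mul_le m hpow.ne'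
  have hupper : (m : ℝ) + 1 ≤ (((m / 10 ^ e : ℤ) : ℝ) + 1) * 10 ^ e := by
    exact_mod_cast (Int.lt_ediv_add_one_mul_self m hpow : m + 1 ≤ _)
  rw [hcancel, le_div_iff₀ (by positivity), div_lt_iff₀ (by positivity)]
  refine ⟨⟨?_, ?_⟩, rfl⟩ <;> linarith

theorem exists_nestedOracle_extending_truncatedOracle {c : ℚ} (hc : 0 < c) {u d : ℕ} {p x : ℝ}
    (hu : IsDecimalCode c u p d) (hx : x ∈ iota u) :
    ∃ φ : ℕ → ℕ, (decimalBasis c).IsNestedOracle φ x ∧ ∀ l < d, φ l = standardOracle c p l := by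
  obtain ⟨m, hd, rfl, rfl⟩ := hu
  rw [iota_decimalCode c (m, d)] at hx
  obtain ⟨N, hN⟩ := exists_decimalInterval_subset_Ioo c hx.1 hx.2
  have hstart (l : ℕ) (hl : l < d) : decimalInterval c (m, d) ⊆
      decimalInterval c (decimalApprox ((m + 1 / 2) / 10 ^ d) (l + 1)) := by
    have hlast : decimalApprox ((m + 1 / 2) / 10 ^ d) d = (m, d) := by
      rw [decimalApprox_midpoint m le_rfl, Nat.sub_self, pow_zero, Int.ediv_one]
    rw [← hlast]
    exact antitone_decimalInterval_decimalApprox hc _ hl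
  let z (l : ℕ) : ℤ × ℕ :=
    if l < d then decimalApprox ((m + 1 / 2) / 10 ^ d) (l + 1) else decimalApprox x (N + l + 1)
  refine ⟨_, isNestedOracle_decimalCode (z := z) (fun l => ?_) (fun l => ?_) (fun l => ?_)
    fun M => ⟨M + d, ?_⟩, fun l hl => ?_⟩
  · unfold z
    split_ifs <;> exact Nat.succ_pos _
  · unfold z
    split_ifs with hl
    · exact hstart l hl hx
    · exact mem_decimalInterval_decimalApprox hc x _
  · by_cases hl : l < d
    · simp only [z, if_pos hl]
      split_ifs
      · exact antitone_decimalInterval_decimalApprox hc _ (Nat.le_succ _)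
      · exact (hN _ (by simp only [decimalApprox]; omega)
          (mem_decimalInterval_decimalApprox hc x _)).trans (hstart l hl)
    · simp only [z, if_neg hl, if_neg (show ¬l + 1 < d by omega)]
      exact antitone_decimalInterval_decimalApprox hc x (by omega)
  · simp only [z, if_neg (show ¬M + d < d by omega), decimalApprox]
    omega
  · simp only [z, if_pos hl, decimalApprox, standardOracle]

theorem standardOracle_midpoint (c : ℚ) (m : ℤ) {l d : ℕ} (hl : l < d) :
    standardOracle c ((m + 1 / 2) / 10 ^ d) l = decimalCode c (m / 10 ^ (d - (l + 1))) (l + 1) :=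
  congrArg (decimalCode c · (l + 1)) (congrArg Prod.fst (decimalApprox_midpoint m hl))

/-- For `c = P / Q`, the integer `m Q - P`, so that the decimal interval of `(m, d)` has the lower
endpoint `(m Q - P) / (Q 10 ^ d)`. -/
def lowerNumerator (c : ℚ) (m : ℤ) : ℤ := m * c.den + -c.num

/-- For `c = P / Q`, the integer `(m + 1) Q + P`, so that the decimal interval of `(m, d)` has the
upper endpoint `((m + 1) Q + P) / (Q 10 ^ d)`. -/
def upperNumerator (c : ℚ) (m : ℤ) : ℤ := (m + 1) * c.den + c.num

theorem primrec_lowerNumerator (c : ℚ) : Primrec (lowerNumerator c) :=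
  primrec_int_add.comp (primrec_int_mul.comp Primrec.id (Primrec.const _)) (Primrec.const _)

theorem primrec_upperNumerator (c : ℚ) : Primrec (upperNumerator c) :=
  primrec_int_add.comp (primrec_int_mul.comp (primrec_int_add.comp Primrec.id (Primrec.const 1))
    (Primrec.const _)) (Primrec.const _)

theorem lowerNumerator_div_den (c : ℚ) (m : ℤ) : (lowerNumerator c m : ℚ) / c.den = m - c := by
  have hden : (c.den : ℚ) ≠ 0 := Nat.cast_ne_zero.2 c.den_nz
  rw [lowerNumerator, Int.cast_add, Int.cast_mul, Int.cast_neg, Int.cast_natCast, add_div,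
    mul_div_cancel_right₀ _ hden, neg_div, Rat.num_div_den, sub_eq_add_neg]

theorem upperNumerator_div_den (c : ℚ) (m : ℤ) :
    (upperNumerator c m : ℚ) / c.den = m + 1 + c := by
  have hden : (c.den : ℚ) ≠ 0 := Nat.cast_ne_zero.2 c.den_nz
  rw [upperNumerator, Int.cast_add, Int.cast_mul, Int.cast_add, Int.cast_one, Int.cast_natCast,
    add_div, mul_div_cancel_right₀ _ hden, Rat.num_div_den]

theorem primrec_decimalCode (c : ℚ) : Primrec₂ (decimalCode c) := by
  have hden : Primrec fun z : ℤ × ℕ => c.den * 10 ^ z.2 :=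
    Primrec.nat_mul.comp (Primrec.const _) (primrec_pow.comp (Primrec.const 10) Primrec.snd)
  have hendpoint {f : ℤ → ℤ} (hf : Primrec f) :=
    primrec_rationalCode_intCast_div.comp (hf.comp Primrec.fst) hden
  refine (primrec_cantorPair.comp (hendpoint (primrec_lowerNumerator c))
    (hendpoint (primrec_upperNumerator c))).of_eq fun z => ?_
  rw [decimalCode, intervalCode, ← sub_div, ← add_div, ← lowerNumerator_div_den,
    ← upperNumerator_div_den, div_div, div_div]
  push_cast
  rfl

theorem decimalInterval_subset_iff {c : ℚ} (hc : 0 < c) (z w : ℤ × ℕ) :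
    decimalInterval c z ⊆ decimalInterval c w ↔
      lowerNumerator c w.1 * 10 ^ z.2 ≤ lowerNumerator c z.1 * 10 ^ w.2 ∧
      upperNumerator c z.1 * 10 ^ w.2 ≤ upperNumerator c w.1 * 10 ^ z.2 := by
  have hden : (0 : ℝ) < c.den := Nat.cast_pos.2 c.den_pos
  have hlower (m : ℤ) : (m - c : ℝ) = lowerNumerator c m / c.den := by
    exact_mod_cast (lowerNumerator_div_den c m).symm
  have hupper (m : ℤ) : (m + 1 + c : ℝ) = upperNumerator c m / c.den := by
    exact_mod_cast (upperNumerator_div_den c m).symm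
  rw [decimalInterval, decimalInterval, Set.Ioo_subset_Ioo_iff
    (decimalInterval_lower_lt_upper hc z), div_le_div_iff₀ (by positivity) (by positivity),
    div_le_div_iff₀ (by positivity) (by positivity), hlower, hlower, hupper, hupper,
    div_mul_eq_mul_div, div_mul_eq_mul_div, div_mul_eq_mul_div, div_mul_eq_mul_div,
    div_le_div_iff_of_pos_right hden, div_le_div_iff_of_pos_right hden]
  norm_cast

theorem primrecRel_decimalInterval_subset {c : ℚ} (hc : 0 < c) :
    PrimrecRel fun z w : ℤ × ℕ => decimalInterval c z ⊆ decimalInterval c w := by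
  have hscaled {f : ℤ → ℤ} (hf : Primrec f) :
      Primrec₂ fun z w : ℤ × ℕ => f z.1 * 10 ^ w.2 :=
    (primrec_int_mul.comp (hf.comp (Primrec.fst.comp Primrec.fst)) (primrec_int_natCast.comp
      (primrec_pow.comp (Primrec.const 10) (Primrec.snd.comp Primrec.snd)))).of_eq fun p => by
        push_cast
        rfl
  have hlower := hscaled (primrec_lowerNumerator c)
  have hupper := hscaled (primrec_upperNumerator c)
  exact ((primrecRel_int_le.comp (hlower.comp Primrec.snd Primrec.fst)
    (hlower.comp Primrec.fst Primrec.snd)).and (primrecRel_int_le.comp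
    (hupper.comp Primrec.fst Primrec.snd) (hupper.comp Primrec.snd Primrec.fst))).of_eq
    fun p => (decimalInterval_subset_iff hc p.1 p.2).symm

end DecimalIntervals

section Search

theorem primrecRel_exists_encode_eq {α ω : Type*} [Primcodable α] [Primcodable ω]
    {P : α → ω → Prop} (hP : PrimrecRel P) :
    PrimrecRel fun (a : α) (n : ℕ) => ∃ w, encode w = n ∧ P a w :=
  (hP.swap.exists_mem_list.comp (Primrec.optionToList.comp (Primrec.decode₂.comp Primrec.snd))
    Primrec.fst).of_eq fun p => by
      simp only [Option.mem_toList, Encodable.decode₂_eq_some, Function.swap]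

theorem exists_computable_semiDecides {α ω : Type*} [Primcodable α] [Primcodable ω]
    {P : α × ℕ → ω → Prop} (hP : PrimrecRel P) :
    ∃ E : α → Code, Computable E ∧ ∀ a, SemiDecides (E a) {r | ∃ w, P (a, r) w} := by
  classical
  obtain ⟨C, hC⟩ := Code.exists_code.1
    (Partrec.rfind (primrecRel_exists_encode_eq hP).decide.to_comp.partrec₂)
  refine ⟨fun a => C.curry (encode a),
    (Code.primrec₂_curry.comp (Primrec.const C) Primrec.encode).to_comp, fun a r => ?_⟩
  have hdecode : Encodable.decode (Nat.pair (encode a) r) = some (a, r) :=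
    Encodable.encodek (a, r)
  simp only [Code.eval_curry, hC, hdecode, Part.coe_some, Part.bind_some, Part.map_Dom,
    Nat.rfind_dom', PFun.coe_val, Part.mem_some_iff, Part.some_dom, eq_comm (a := true),
    decide_eq_true_eq]
  constructor
  · rintro ⟨_, ⟨w, -, hw⟩, -⟩
    exact ⟨w, hw⟩
  · rintro ⟨w, hw⟩
    exact ⟨encode w, ⟨w, rfl, hw⟩, fun _ => trivial⟩

end Search

namespace OracleCode

variable {k : ℕ}

theorem mem_eval_left_pair (φ : Fin k → ℕ →. ℕ) (a b : ℕ) : a ∈ eval φ left (Nat.pair a b) := by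
  simp only [eval, Nat.unpair_pair, Part.mem_some]

theorem mem_eval_right_pair (φ : Fin k → ℕ →. ℕ) (a b : ℕ) : b ∈ eval φ right (Nat.pair a b) := by
  simp only [eval, Nat.unpair_pair, Part.mem_some]

theorem mem_eval_pair {φ : Fin k → ℕ →. ℕ} {f g : OracleCode k} {n v : ℕ} :
    v ∈ eval φ (pair f g) n ↔ ∃ a ∈ eval φ f n, ∃ b ∈ eval φ g n, Nat.pair a b = v := by
  simp only [eval, Seq.seq, Part.map_eq_map, Part.bind_map, Part.mem_bind_iff, Part.mem_map_iff]

theorem mem_eval_comp {φ : Fin k → ℕ →. ℕ} {f g : OracleCode k} {n v : ℕ} :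
    v ∈ eval φ (comp f g) n ↔ ∃ a ∈ eval φ g n, v ∈ eval φ f a :=
  Part.mem_bind_iff

theorem mem_eval_rfind {φ : Fin k → ℕ →. ℕ} {f : OracleCode k} {a n : ℕ} :
    n ∈ eval φ (rfind f) a ↔ 0 ∈ eval φ f (Nat.pair a n) ∧
      ∀ m < n, ∃ v ∈ eval φ f (Nat.pair a m), v ≠ 0 := by
  refine Nat.mem_rfind.trans ?_
  simp only [Part.map_eq_map, Part.mem_map_iff, decide_eq_true_eq, decide_eq_false_iff_not,
    exists_eq_right, ne_eq]

theorem eval_prec_zero (φ : Fin k → ℕ →. ℕ) (f g : OracleCode k) (a : ℕ) :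
    eval φ (prec f g) (Nat.pair a 0) = eval φ f a := by
  simp only [eval, Nat.unpair_pair]
  rfl

theorem mem_eval_prec_succ {φ : Fin k → ℕ →. ℕ} {f g : OracleCode k} {a n v : ℕ} :
    v ∈ eval φ (prec f g) (Nat.pair a (n + 1)) ↔ ∃ i ∈ eval φ (prec f g) (Nat.pair a n),
      v ∈ eval φ g (Nat.pair a (Nat.pair n i)) := by
  simp only [eval, Nat.unpair_pair]
  exact Part.mem_bind_iff

theorem eval_mono {φ φ' : Fin k → ℕ →. ℕ} (h : ∀ i n v, v ∈ φ i n → v ∈ φ' i n)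
    (κ : OracleCode k) {n v : ℕ} (hv : v ∈ eval φ κ n) : v ∈ eval φ' κ n := by
  induction κ generalizing n v with
  | zero | succ | left | right => exact hv
  | oracle i => exact h i _ _ hv
  | pair f g hf hg =>
    obtain ⟨a, ha, b, hb, rfl⟩ := mem_eval_pair.1 hv
    exact mem_eval_pair.2 ⟨a, hf ha, b, hg hb, rfl⟩
  | comp f g hf hg =>
    obtain ⟨a, ha, hb⟩ := mem_eval_comp.1 hv
    exact mem_eval_comp.2 ⟨a, hg ha, hf hb⟩
  | prec f g hf hg =>
    obtain ⟨a, n, rfl⟩ : ∃ a m, Nat.pair a m = n := ⟨_, _, Nat.pair_unpair n⟩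
    induction n generalizing v with
    | zero =>
      rw [eval_prec_zero] at hv ⊢
      exact hf hv
    | succ n ih =>
      rw [mem_eval_prec_succ] at hv ⊢
      obtain ⟨i, hi, hv⟩ := hv
      exact ⟨i, ih hi, hg hv⟩
  | rfind f hf =>
    obtain ⟨hzero, hne⟩ := mem_eval_rfind.1 hv
    refine mem_eval_rfind.2 ⟨hf hzero, fun m hm => ?_⟩
    obtain ⟨v, hv, hv'⟩ := hne m hm
    exact ⟨v, hf hv, hv'⟩

theorem partrec_eval {α : Type*} [Primcodable α] {φ : α → Fin k → ℕ →. ℕ}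
    (hφ : ∀ i, Partrec₂ fun a n => φ a i n) (κ : OracleCode k) :
    Partrec₂ fun a n => eval (φ a) κ n := by
  induction κ with
  | zero => exact (Computable.const 0).partrec
  | succ => exact (Computable.succ.comp Computable.snd).partrec
  | left => exact (Computable.fst.comp (Computable.unpair.comp Computable.snd)).partrec
  | right => exact (Computable.snd.comp (Computable.unpair.comp Computable.snd)).partrec
  | oracle i => exact hφ i
  | pair f g hf hg =>
    refine (hf.bind ((hg.comp (Computable.fst.comp Computable.fst)
      (Computable.snd.comp Computable.fst)).map
      (Primrec₂.natPair.to_comp.comp (Computable.snd.comp Computable.fst)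
        Computable.snd).to₂).to₂).of_eq fun p => ?_
    simp only [eval, Seq.seq, Part.map_eq_map, Part.bind_map]
  | comp f g hf hg =>
    exact hg.bind (hf.comp (Computable.fst.comp Computable.fst) Computable.snd)
  | prec f g hf hg =>
    have hleft : Computable fun p : α × ℕ => p.2.unpair.1 :=
      Computable.fst.comp (Computable.unpair.comp Computable.snd)
    have hright : Computable fun p : α × ℕ => p.2.unpair.2 :=
      Computable.snd.comp (Computable.unpair.comp Computable.snd)
    exact Partrec.nat_rec hright (hf.comp Computable.fst hleft)
      (hg.comp (Computable.fst.comp Computable.fst)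
        (Primrec₂.natPair.to_comp.comp (hleft.comp Computable.fst)
          (Primrec₂.natPair.to_comp.comp (Computable.fst.comp Computable.snd)
            (Computable.snd.comp Computable.snd)))).to₂
  | rfind f hf =>
    exact Partrec.rfind ((hf.comp (Computable.fst.comp Computable.fst)
      (Primrec₂.natPair.to_comp.comp (Computable.snd.comp Computable.fst) Computable.snd)).map
      (Primrec.eq.decide.comp Primrec.snd (Primrec.const 0)).to_comp.to₂)

theorem exists_eval_eq_of_partrec {f : ℕ →. ℕ} (hf : Nat.Partrec f) :
    ∃ κ : OracleCode k, ∀ φ, eval φ κ = f := by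
  induction hf with
  | zero => exact ⟨zero, fun _ => rfl⟩
  | succ => exact ⟨succ, fun _ => rfl⟩
  | left => exact ⟨left, fun _ => rfl⟩
  | right => exact ⟨right, fun _ => rfl⟩
  | pair _ _ hf hg =>
    obtain ⟨κ, hκ⟩ := hf
    obtain ⟨κ', hκ'⟩ := hg
    exact ⟨pair κ κ', fun φ => by simp only [eval, hκ, hκ']; rfl⟩
  | comp _ _ hf hg =>
    obtain ⟨κ, hκ⟩ := hf
    obtain ⟨κ', hκ'⟩ := hg
    exact ⟨comp κ κ', fun φ => by simp only [eval, hκ, hκ']; rfl⟩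
  | prec _ _ hf hg =>
    obtain ⟨κ, hκ⟩ := hf
    obtain ⟨κ', hκ'⟩ := hg
    exact ⟨prec κ κ', fun φ => by simp only [eval, hκ, hκ']; rfl⟩
  | rfind _ hf =>
    obtain ⟨κ, hκ⟩ := hf
    exact ⟨rfind κ, fun φ => by simp only [eval, hκ]; rfl⟩

theorem exists_encode_mem_eval_of_computable {α σ : Type*} [Primcodable α] [Primcodable σ]
    {f : α → σ} (hf : Computable f) :
    ∃ κ : OracleCode k, ∀ φ a, encode (f a) ∈ eval φ κ (encode a) := by
  obtain ⟨κ, hκ⟩ := exists_eval_eq_of_partrec (k := k) hf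
  refine ⟨κ, fun φ a => ?_⟩
  rw [hκ]
  simp only [Encodable.encodek, Part.coe_some, Part.bind_some, PFun.coe_val, Part.map_some,
    Part.mem_some]

/-- A program for the constant function `n`. -/
def const : ℕ → OracleCode k
  | 0 => zero
  | n + 1 => comp succ (const n)

theorem mem_eval_const (φ : Fin k → ℕ →. ℕ) (n m : ℕ) : n ∈ eval φ (const n) m := by
  induction n with
  | zero => exact Part.mem_some 0
  | succ n ih => exact mem_eval_comp.2 ⟨n, ih, Part.mem_some _⟩

theorem primrec_toNat_const : Primrec fun n => (const n : OracleCode k).toNat := by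
  have hstep : Primrec₂ fun (_ : ℕ) (q : ℕ) => Nat.pair 6 (Nat.pair (Nat.pair 1 0) q) :=
    Primrec₂.natPair.comp (Primrec.const 6)
      (Primrec₂.natPair.comp (Primrec.const (Nat.pair 1 0)) Primrec.snd)
  refine (Primrec.nat_rec₁ (Nat.pair 0 0) hstep).of_eq fun n => ?_
  induction n with
  | zero => rfl
  | succ n ih => simp only [const, toNat, ← ih]

/-- The program that runs `κ` on the pair of the constant `n` and the argument. -/
def curry (κ : OracleCode k) (n : ℕ) : OracleCode k := comp κ (pair (const n) (pair left right))

theorem mem_eval_curry {φ : Fin k → ℕ →. ℕ} {κ : OracleCode k} {n m v : ℕ}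
    (hv : v ∈ eval φ κ (Nat.pair n m)) : v ∈ eval φ (curry κ n) m :=
  mem_eval_comp.2 ⟨_, mem_eval_pair.2 ⟨n, mem_eval_const φ n m, m, mem_eval_pair.2
    ⟨_, Part.mem_some _, _, Part.mem_some _, Nat.pair_unpair m⟩, rfl⟩, hv⟩

theorem primrec_toNat_curry (κ : OracleCode k) : Primrec fun n => (curry κ n).toNat :=
  Primrec₂.natPair.comp (Primrec.const 6) (Primrec₂.natPair.comp (Primrec.const κ.toNat)
    (Primrec₂.natPair.comp (Primrec.const 5) (Primrec₂.natPair.comp primrec_toNat_const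
      (Primrec.const (pair left right : OracleCode k).toNat))))

theorem exists_encode_map_mem_eval (L : List (Fin k)) :
    ∃ κ : OracleCode k, ∀ (φ : Fin k → ℕ → ℕ) (t : ℕ),
      encode (L.map fun i => φ i t) ∈ eval (fun i => (φ i : ℕ →. ℕ)) κ t := by
  induction L with
  | nil => exact ⟨zero, fun _ _ => Part.mem_some 0⟩
  | cons i L ih =>
    obtain ⟨κ, hκ⟩ := ih
    exact ⟨comp succ (pair (oracle i) κ), fun φ t => mem_eval_comp.2
      ⟨_, mem_eval_pair.2 ⟨_, Part.mem_some (φ i t), _, hκ φ t, rfl⟩, Part.mem_some _⟩⟩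

section Search

variable {α ω : Type*} [Primcodable α] [Primcodable ω]

theorem exists_encode_mem_eval_of_computable_values {σ : Type*} [Primcodable σ]
    {f : (α × ℕ) × (Fin k → ℕ) → σ} (hf : Computable f) :
    ∃ κ : OracleCode k, ∀ (φ : Fin k → ℕ → ℕ) (a : α) (n : ℕ),
      encode (f ((a, n), fun i => φ i n.unpair.1)) ∈
        eval (fun i => (φ i : ℕ →. ℕ)) κ (Nat.pair (encode a) n) := by
  obtain ⟨values, hvalues⟩ := exists_encode_map_mem_eval (List.finRange k)
  have hlookup : Primrec fun (L : List ℕ) (i : Fin k) => L.getD i 0 :=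
    Primrec.fin_curry.2 ((Primrec.list_getD 0).comp Primrec.fst
      (Primrec.fin_val.comp Primrec.snd))
  obtain ⟨κ, hκ⟩ := exists_encode_mem_eval_of_computable (k := k)
    (hf.comp (Primrec.fst.pair (hlookup.comp Primrec.snd) :
      Primrec fun q : (α × ℕ) × List ℕ => (q.1, fun i : Fin k => q.2.getD i 0)).to_comp)
  refine ⟨comp κ (pair (pair left right) (comp values (comp left right))), fun φ a n => ?_⟩
  have hn := mem_eval_right_pair (fun i => (φ i : ℕ →. ℕ)) (encode a) n
  refine mem_eval_comp.2 ⟨_, mem_eval_pair.2 ⟨_, mem_eval_pair.2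
    ⟨_, mem_eval_left_pair _ _ _, _, hn, rfl⟩, _, mem_eval_comp.2
    ⟨_, mem_eval_comp.2 ⟨_, hn, Part.mem_some _⟩, hvalues φ _⟩, rfl⟩, ?_⟩
  simpa using hκ (fun i => (φ i : ℕ →. ℕ)) ((a, n), (List.finRange k).map fun i => φ i n.unpair.1)

theorem exists_search {P : α × (Fin k → ℕ) → ω → Prop} (hP : PrimrecRel P) :
    ∃ κ : OracleCode k, ∀ (φ : Fin k → ℕ → ℕ) (a : α), (∃ t w, P (a, fun i => φ i t) w) →
      ∃ t w, P (a, fun i => φ i t) w ∧ encode w ∈ eval (fun i => (φ i : ℕ →. ℕ)) κ (encode a) := by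
  classical
  have htest : Computable fun q : (α × ℕ) × (Fin k → ℕ) =>
      if ∃ w, encode w = q.1.2.unpair.2 ∧ P (q.1.1, q.2) w then 0 else 1 :=
    (Primrec.ite ((primrecRel_exists_encode_eq hP).comp
      ((Primrec.fst.comp Primrec.fst).pair Primrec.snd)
      (Primrec.snd.comp (Primrec.unpair.comp (Primrec.snd.comp Primrec.fst))))
      (Primrec.const 0) (Primrec.const 1)).to_comp
  obtain ⟨test, htest⟩ := exists_encode_mem_eval_of_computable_values htest
  refine ⟨comp right (rfind test), fun φ a hex => ?_⟩
  have hfound : ∃ n : ℕ, ∃ w, encode w = n.unpair.2 ∧ P (a, fun i => φ i n.unpair.1) w := by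
    obtain ⟨t, w, hw⟩ := hex
    exact ⟨Nat.pair t (encode w), w, by simpa using hw⟩
  obtain ⟨w, hencode, hw⟩ := Nat.find_spec hfound
  refine ⟨_, w, hw, mem_eval_comp.2 ⟨Nat.find hfound, mem_eval_rfind.2 ⟨?_, fun m hm => ?_⟩, ?_⟩⟩
  · have hval := htest φ a (Nat.find hfound)
    rwa [if_pos (Nat.find_spec hfound)] at hval
  · have hval := htest φ a m
    rw [if_neg (Nat.find_min hfound hm)] at hval
    exact ⟨1, hval, one_ne_zero⟩
  · exact hencode ▸ Part.mem_some _

end Search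

/-- The program for the iteration `m ↦ vₘ` at the argument `a` given by `v₀ = 0` and
`vₘ₊₁ = search(⟨a, ⟨m, vₘ⟩⟩) + 1`. The shift makes `vₘ` the code of an option: `v₀` is the code of
`none`, and `vₘ₊₁` is the code of `some w` if `search` returns the code of `w`. -/
def iterate (search : OracleCode k) : OracleCode k := prec zero (comp succ search)

theorem exists_encode_mem_eval_iterate {ω : Type*} [Encodable ω] {φ : Fin k → ℕ →. ℕ}
    {search : OracleCode k} {a : ℕ} {S : Option ω → ω → Prop}
    (hsearch : ∀ m q, (∀ w ∈ q, ∃ q', S q' w) →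
      ∃ w, S q w ∧ encode w ∈ eval φ search (Nat.pair a (Nat.pair m (encode q)))) :
    ∃ w : ℕ → ω, (∀ m, encode (some (w m)) ∈ eval φ (iterate search) (Nat.pair a (m + 1))) ∧
      S none (w 0) ∧ ∀ m, S (some (w m)) (w (m + 1)) := by
  have hnext (m : ℕ) (q : Option ω) (hq : encode q ∈ eval φ (iterate search) (Nat.pair a m))
      (hS : ∀ w ∈ q, ∃ q', S q' w) :
      ∃ w, S q w ∧ encode (some w) ∈ eval φ (iterate search) (Nat.pair a (m + 1)) := by
    obtain ⟨w, hw, heval⟩ := hsearch m q hS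
    exact ⟨w, hw, mem_eval_prec_succ.2 ⟨_, hq, mem_eval_comp.2 ⟨_, heval, Part.mem_some _⟩⟩⟩
  have hzero : encode (none : Option ω) ∈ eval φ (iterate search) (Nat.pair a 0) := by
    rw [iterate, eval_prec_zero]
    exact Part.mem_some 0
  have hvalue (m : ℕ) : ∃ w, (∃ q, S q w) ∧
      encode (some w) ∈ eval φ (iterate search) (Nat.pair a (m + 1)) := by
    induction m with
    | zero =>
      obtain ⟨w, hw, heval⟩ := hnext 0 none hzero (by simp)
      exact ⟨w, ⟨_, hw⟩, heval⟩
    | succ m ih =>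
      obtain ⟨v, hv, hveval⟩ := ih
      obtain ⟨w, hw, heval⟩ := hnext (m + 1) (some v) hveval (by simpa using hv)
      exact ⟨w, ⟨_, hw⟩, heval⟩
  choose w hS heval using hvalue
  have hstep (m : ℕ) (q : Option ω) (hqS : ∀ w ∈ q, ∃ q', S q' w)
      (hq : encode q ∈ eval φ (iterate search) (Nat.pair a m)) : S q (w m) := by
    obtain ⟨v, hv, hveval⟩ := hnext m q hq hqS
    rwa [Option.some_injective _ (Encodable.encode_injective (Part.mem_unique hveval (heval m)))]
      at hv
  exact ⟨w, heval, hstep 0 none (by simp) hzero,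
    fun m => hstep (m + 1) (some (w m)) (by simpa using hS m) (heval m)⟩

theorem exists_iterated_search {α ω : Type*} [Primcodable α] [Primcodable ω]
    {P : (α × Option ω) × (Fin k → ℕ) → ω → Prop} (hP : PrimrecRel P) :
    ∃ κ : OracleCode k, ∀ (φ : Fin k → ℕ → ℕ) (a : α),
      (∀ q : Option ω, (∀ w ∈ q, ∃ q' t, P ((a, q'), fun i => φ i t) w) →
        ∃ t w, P ((a, q), fun i => φ i t) w) →
      ∃ w : ℕ → ω,
        (∀ m, encode (w m) ∈ eval (fun i => (φ i : ℕ →. ℕ)) κ (Nat.pair (encode a) m)) ∧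
        (∃ t, P ((a, none), fun i => φ i t) (w 0)) ∧
        ∀ m, ∃ t, P ((a, some (w m)), fun i => φ i t) (w (m + 1)) := by
  have hP' : PrimrecRel fun (b : (α × ℕ × Option ω) × (Fin k → ℕ)) (w : ω) =>
      P ((b.1.1, b.1.2.2), b.2) w :=
    hP.comp (((Primrec.fst.comp (Primrec.fst.comp Primrec.fst)).pair
      (Primrec.snd.comp (Primrec.snd.comp (Primrec.fst.comp Primrec.fst)))).pair
      (Primrec.snd.comp Primrec.fst)) Primrec.snd
  obtain ⟨search, hsearch⟩ := exists_search hP'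
  obtain ⟨pred, hpred⟩ := exists_encode_mem_eval_of_computable (k := k) Primrec.pred.to_comp
  refine ⟨comp pred (comp (iterate search) (pair left (comp succ right))), fun φ a hex => ?_⟩
  obtain ⟨w, heval, hfirst, hnext⟩ := exists_encode_mem_eval_iterate
    (φ := fun i => (φ i : ℕ →. ℕ)) (search := search) (a := encode a)
    (S := fun q w => ∃ t, P ((a, q), fun i => φ i t) w) fun m q hq => by
      obtain ⟨t, w, hw, heval⟩ := hsearch φ (a, m, q) (hex q hq)
      exact ⟨w, ⟨t, hw⟩, heval⟩
  exact ⟨w, fun m => mem_eval_comp.2 ⟨_, mem_eval_comp.2 ⟨_, mem_eval_pair.2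
    ⟨_, mem_eval_left_pair _ _ _, _, mem_eval_comp.2 ⟨_, mem_eval_right_pair _ _ _,
      Part.mem_some _⟩, rfl⟩, heval m⟩, hpred _ _⟩, hfirst, hnext⟩

end OracleCode

section ConstructedStates

theorem exists_primrec_eq_some_iff {α : Type*} [Primcodable α] {f : α →. ℕ} (hf : Partrec f) :
    ∃ F : α → ℕ → Option ℕ, Primrec₂ F ∧ ∀ a v, v ∈ f a ↔ ∃ N, F a N = some v := by
  obtain ⟨C, hC⟩ := Code.exists_code.1 hf
  refine ⟨fun a N => Code.evaln N C (encode a), Code.primrec_evaln.comp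
    ((Primrec.snd.pair (Primrec.const C)).pair (Primrec.encode.comp Primrec.fst)), fun a v => ?_⟩
  have heval : v ∈ C.eval (encode a) ↔ v ∈ f a := by
    simp [hC]
  rw [← heval, Code.evaln_complete]
  rfl

/-- The finite oracle `σᵤ`, where `u` is the code of the decimal interval given by `z`. The value
`none` stands for an undefined one. -/
def midpointOracle (c : ℚ) (z : ℤ × ℕ) (l : ℕ) : Option ℕ :=
  if l < z.2 then some (decimalCode c (z.1 / (10 ^ (z.2 - (l + 1)) : ℕ)) (l + 1)) else none

theorem truncatedOracle_midpoint (c : ℚ) (m : ℤ) (d : ℕ) :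
    truncatedOracle c ((m + 1 / 2) / 10 ^ d) d = fun l => ↑(midpointOracle c (m, d) l) := by
  funext l
  have hmem (v : ℕ) : v ∈ truncatedOracle c ((m + 1 / 2) / 10 ^ d) d l ↔
      ∃ _ : l < d, standardOracle c ((m + 1 / 2) / 10 ^ d) l = v := Iff.rfl
  refine Part.ext fun v => ?_
  rw [hmem, midpointOracle]
  split_ifs with hl
  · rw [standardOracle_midpoint c m hl]
    simp [hl, eq_comm]
  · simp [hl]

theorem primrec_midpointOracle (c : ℚ) : Primrec₂ (midpointOracle c) := by
  have hpow : Primrec fun p : (ℤ × ℕ) × ℕ => 10 ^ (p.1.2 - (p.2 + 1)) :=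
    primrec_pow.comp (Primrec.const 10) (Primrec.nat_sub.comp (Primrec.snd.comp Primrec.fst)
      (Primrec.succ.comp Primrec.snd))
  exact Primrec.ite (Primrec.nat_lt.comp Primrec.snd (Primrec.snd.comp Primrec.fst))
    (Primrec.option_some.comp ((primrec_decimalCode c).comp
      (primrec_int_ediv_natCast.comp (Primrec.fst.comp Primrec.fst) hpow)
      (Primrec.succ.comp Primrec.snd))) (Primrec.const none)

theorem mem_constructedStates_iff {k l : ℕ} {c : ℚ} {κ : Fin l → OracleCode k} {r : ℕ} :
    r ∈ constructedStates c κ ↔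
      ∃ (u : Fin (k + l) → ℕ) (z : Fin k → ℤ × ℕ) (m : Fin l → ℕ), r = tupleCode (k + l) u ∧
        (∀ i, 0 < (z i).2 ∧ u (Fin.castAdd l i) = decimalCode c (z i).1 (z i).2) ∧
        ∀ j, u (Fin.natAdd k j) ∈ (κ j).eval
          (fun i t => ↑(midpointOracle c (z i) t)) (m j) := by
  constructor
  · rintro ⟨u, rfl, p, d, hpd, hj⟩
    choose m hd hu hp using hpd
    choose t ht using hj
    obtain rfl := funext hp
    refine ⟨u, fun i => (m i, d i), t, rfl, fun i => ⟨hd i, hu i⟩, fun j => ?_⟩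
    simpa only [truncatedOracle_midpoint] using ht j
  · rintro ⟨u, z, m, rfl, hz, hm⟩
    refine ⟨u, rfl, _, fun i => (z i).2, fun i => ⟨(z i).1, (hz i).1, (hz i).2, rfl⟩,
      fun j => ⟨m j, ?_⟩⟩
    simpa only [truncatedOracle_midpoint] using hm j

theorem primrecRel_eq_decimalCode {k : ℕ} (c : ℚ) :
    PrimrecRel fun (u : Fin k → ℕ) (z : Fin k → ℤ × ℕ) =>
      ∀ i, 0 < (z i).2 ∧ u i = decimalCode c (z i).1 (z i).2 := by
  have hu (i) : Primrec fun p : (Fin k → ℕ) × (Fin k → ℤ × ℕ) => p.1 i :=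
    Primrec.fin_app.comp Primrec.fst (Primrec.const i)
  have hz (i) : Primrec fun p : (Fin k → ℕ) × (Fin k → ℤ × ℕ) => p.2 i :=
    Primrec.fin_app.comp Primrec.snd (Primrec.const i)
  exact primrecPred_forall_fin fun i =>
    (Primrec.nat_lt.comp (Primrec.const 0) (Primrec.snd.comp (hz i))).and
      (Primrec.eq.comp (hu i) ((primrec_decimalCode c).comp
        (Primrec.fst.comp (hz i)) (Primrec.snd.comp (hz i))))

theorem exists_primrec_eval_midpointOracle {k : ℕ} (c : ℚ) (κ : OracleCode k) :
    ∃ F : (Fin k → ℤ × ℕ) × ℕ → ℕ → Option ℕ, Primrec₂ F ∧ ∀ z m v,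
      v ∈ κ.eval (fun i t => ↑(midpointOracle c (z i) t)) m ↔ ∃ N, F (z, m) N = some v := by
  have horacle (i) : Partrec₂ fun (z : Fin k → ℤ × ℕ) t =>
      (↑(midpointOracle c (z i) t) : Part ℕ) :=
    ((primrec_midpointOracle c).comp (Primrec.fin_app.comp Primrec.fst (Primrec.const i))
      Primrec.snd).to_comp.ofOption
  obtain ⟨F, hF, hmem⟩ := exists_primrec_eq_some_iff (OracleCode.partrec_eval horacle κ)
  exact ⟨F, hF, fun z m v => hmem (z, m) v⟩

theorem exists_semiDecides_constructedStates {k l : ℕ} (c : ℚ) (κ : Fin l → OracleCode k) :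
    ∃ e, SemiDecides e (constructedStates c κ) := by
  choose F hF hmem using fun j => exists_primrec_eval_midpointOracle c (κ j)
  let Witness := ((Fin (k + l) → ℕ) × (Fin k → ℤ × ℕ)) × (Fin l → ℕ) × (Fin l → ℕ)
  let P (r : Unit × ℕ) (w : Witness) : Prop :=
    r.2 = tupleCode (k + l) w.1.1 ∧
      (∀ i, 0 < (w.1.2 i).2 ∧
        w.1.1 (Fin.castAdd l i) = decimalCode c (w.1.2 i).1 (w.1.2 i).2) ∧
      ∀ j, F j (w.1.2, w.2.1 j) (w.2.2 j) = some (w.1.1 (Fin.natAdd k j))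
  have hP : PrimrecRel P := by
    have hw : Primrec fun p : (Unit × ℕ) × Witness => p.2 := Primrec.snd
    have hu := Primrec.fst.comp (Primrec.fst.comp hw)
    have hcast : Primrec₂ fun (u : Fin (k + l) → ℕ) (i : Fin k) => u (Fin.castAdd l i) :=
      Primrec.fin_app.comp Primrec.fst ((Primrec.dom_finite _).comp Primrec.snd)
    have hinput := (primrecRel_eq_decimalCode c).comp ((Primrec.fin_curry.2 hcast).comp hu)
      (Primrec.snd.comp (Primrec.fst.comp hw))
    have houtput (j) := Primrec.eq.comp ((hF j).comp ((Primrec.snd.comp (Primrec.fst.comp hw)).pair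
        (Primrec.fin_app.comp (Primrec.fst.comp (Primrec.snd.comp hw)) (Primrec.const j)))
        (Primrec.fin_app.comp (Primrec.snd.comp (Primrec.snd.comp hw)) (Primrec.const j)))
      (Primrec.option_some.comp (Primrec.fin_app.comp hu (Primrec.const (Fin.natAdd k j))))
    have hstate := Primrec.eq.comp (Primrec.snd.comp Primrec.fst)
      ((primrec_tupleCode (k + l)).comp hu)
    exact (hstate.and (hinput.and (primrecPred_forall_fin houtput))).primrecRel
  obtain ⟨E, -, hE⟩ := exists_computable_semiDecides hP
  refine ⟨E (), fun r => (hE () r).trans ?_⟩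
  rw [mem_constructedStates_iff]
  constructor
  · rintro ⟨⟨⟨u, z⟩, m, N⟩, hr, hz, hN⟩
    exact ⟨u, z, m, hr, hz, fun j => (hmem j z (m j) _).2 ⟨N j, hN j⟩⟩
  · rintro ⟨u, z, m, hr, hz, hm⟩
    choose N hN using fun j => (hmem j z (m j) _).1 (hm j)
    exact ⟨((u, z), m, N), hr, hz, hN⟩

end ConstructedStates

namespace CodedBasis

variable {X : Type*} {n : ℕ}

theorem coding_power_tupleCode (T : CodedBasis X) (u : Fin n → ℕ) :
    (T.power n).coding (tupleCode n u) = Set.univ.pi fun i => T.coding (u i) := by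
  ext x
  constructor
  · rintro ⟨a, ha, hx⟩ i _
    rw [tupleCode_injective _ ha]
    exact hx i
  · intro hx
    exact ⟨u, rfl, fun i => hx i trivial⟩

theorem mem_dom_of_tupleCode_mem_dom_power {T : CodedBasis X} {u : Fin n → ℕ}
    (hu : tupleCode n u ∈ (T.power n).dom) (hne : (Set.univ.pi fun i => T.coding (u i)).Nonempty)
    (i : Fin n) : u i ∈ T.dom := by
  obtain ⟨b, hb, hub⟩ := hu
  rw [coding_power_tupleCode] at hub
  have hfactor := congrArg (Function.eval i '' ·) hub
  simp only [Set.eval_image_univ_pi hne, Set.eval_image_univ_pi (hub ▸ hne)] at hfactor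
  change T.coding (u i) ∈ T.basis
  exact hfactor ▸ hb i

theorem IsBasicRepresentation.exists_tupleCode_mem {T : CodedBasis X} {R : Set ℕ}
    {A : Set (Fin n → X)} (hR : (T.power n).IsBasicRepresentation R A) {y : Fin n → X}
    (hy : y ∈ A) {v : Fin n → ℕ} (hv : ∀ i, v i ∈ T.dom) (hyv : ∀ i, y i ∈ T.coding (v i)) :
    ∃ u, tupleCode n u ∈ R ∧
      ∀ i, u i ∈ T.dom ∧ y i ∈ T.coding (u i) ∧ T.coding (u i) ⊆ T.coding (v i) := by
  obtain ⟨L, ⟨-, hyL, hL⟩, hLR⟩ := (hR.2 y).1 hy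
  obtain ⟨U, hU, hUv⟩ := hL (Set.univ.pi fun i => T.coding (v i)) ⟨_, hv, rfl⟩ fun i _ => hyv i
  have hyU := hyL U hU
  obtain ⟨r, hr, rfl⟩ := hLR hU
  obtain ⟨u, rfl, hyu⟩ := hyU
  rw [coding_power_tupleCode] at hUv
  have hne : (Set.univ.pi fun i => T.coding (u i)).Nonempty := ⟨y, fun i _ => hyu i⟩
  refine ⟨u, hr, fun i => ⟨mem_dom_of_tupleCode_mem_dom_power (hR.1 hr) hne i, hyu i, ?_⟩⟩
  rcases Set.univ_pi_subset_univ_pi_iff.1 hUv with hsub | ⟨i', hempty⟩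
  · exact hsub i
  · exact absurd (hyu i') (hempty ▸ Set.notMem_empty _)

end CodedBasis

section Prediction

variable {k l n : ℕ} {c : ℚ}

/-- The code of the product of the decimal intervals given by `z₁, …, zₙ`. -/
def boxCode (c : ℚ) (z : Fin n → ℤ × ℕ) : ℕ := tupleCode n fun i => decimalCode c (z i).1 (z i).2

theorem exists_boxCode_mem_of_isBasicRepresentation (hc : 0 < c) {R : Set ℕ} {A : Set (Fin n → ℝ)}
    (hR : ((decimalBasis c).power n).IsBasicRepresentation R A) {y : Fin n → ℝ} (hy : y ∈ A)
    (d : ℕ) :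
    ∃ z : Fin n → ℤ × ℕ, boxCode c z ∈ R ∧ ∀ i, 0 < (z i).2 ∧ y i ∈ decimalInterval c (z i) ∧
      decimalInterval c (z i) ⊆ decimalInterval c (decimalApprox (y i) (d + 1)) := by
  have coding_eq (z : ℤ × ℕ) : (decimalBasis c).coding (decimalCode c z.1 z.2) =
      decimalInterval c z := iota_decimalCode c z
  let v (i : Fin n) := decimalApprox (y i) (d + 1)
  obtain ⟨u, huR, hu⟩ := hR.exists_tupleCode_mem hy (v := fun i => decimalCode c (v i).1 (v i).2)
    (fun i => (mem_dom_decimalBasis_iff hc).2 ⟨v i, d.succ_pos, rfl⟩)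
    fun i => coding_eq (v i) ▸ mem_decimalInterval_decimalApprox hc (y i) (d + 1)
  choose z hz huz using fun i => (mem_dom_decimalBasis_iff hc).1 (hu i).1
  obtain rfl : u = fun i => decimalCode c (z i).1 (z i).2 := funext huz
  simp only [coding_eq] at hu
  exact ⟨z, huR, fun i => ⟨hz i, (hu i).2⟩⟩

theorem eq_of_forall_mem_decimalInterval_decimalApprox (hc : 0 < c) {x y : ℝ}
    (h : ∀ d, y ∈ decimalInterval c (decimalApprox x (d + 1))) : y = x := by
  refine eq_of_forall_dist_le fun ε hε => ?_
  obtain ⟨N, hN⟩ := exists_decimalInterval_subset_Ioo c (sub_lt_self x hε)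
    (lt_add_of_pos_right x hε)
  have hy := hN _ N.le_succ (mem_decimalInterval_decimalApprox hc x (N + 1)) (h N)
  rw [← Real.ball_eq_Ioo] at hy
  exact (Metric.mem_ball.1 hy).le

/-- The set `R` of codes of boxes predicts the values of `ψ`: a box in `R` around `x` in the first
`k` coordinates bounds `ψ x`, and every point of the graph of `ψ` lies in arbitrarily small boxes
in `R`. -/
structure IsPredictive (c : ℚ) (R : Set ℕ) (ψ : (Fin k → ℝ) → (Fin l → ℝ)) : Prop where
  sound : ∀ z : Fin (k + l) → ℤ × ℕ, boxCode c z ∈ R → ∀ x : Fin k → ℝ,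
    (∀ i, x i ∈ decimalInterval c (z (Fin.castAdd l i))) →
      ∀ j, ψ x j ∈ decimalInterval c (z (Fin.natAdd k j))
  precise : ∀ y ∈ graphSet ψ, ∀ d : ℕ, ∃ z : Fin (k + l) → ℤ × ℕ, boxCode c z ∈ R ∧
    ∀ i, 0 < (z i).2 ∧ y i ∈ decimalInterval c (z i) ∧
      decimalInterval c (z i) ⊆ decimalInterval c (decimalApprox (y i) (d + 1))

theorem mem_iota_of_mem_constructedStates (hc : 0 < c) {ψ : (Fin k → ℝ) → (Fin l → ℝ)}
    {κ : Fin l → OracleCode k} (hκ : ComputesOnNestedOracles c ψ κ) {u : Fin (k + l) → ℕ}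
    (hu : tupleCode (k + l) u ∈ constructedStates c κ) {x : Fin k → ℝ}
    (hx : ∀ i, x i ∈ iota (u (Fin.castAdd l i))) (j : Fin l) :
    ψ x j ∈ iota (u (Fin.natAdd k j)) := by
  obtain ⟨u', hu', p, d, hinput, houtput⟩ := hu
  obtain rfl := tupleCode_injective _ hu'
  choose φ hφ hextends using fun i =>
    exists_nestedOracle_extending_truncatedOracle hc (hinput i) (hx i)
  obtain ⟨f, hf, hψ⟩ := hκ x φ hφ j
  obtain ⟨m, hm⟩ := houtput j
  have hrun : u (Fin.natAdd k j) ∈ (κ j).eval (fun i => (φ i : ℕ →. ℕ)) m := by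
    refine OracleCode.eval_mono (fun i t v hv => ?_) _ hm
    obtain ⟨ht, rfl⟩ := hv
    rw [PFun.coe_val, Part.mem_some_iff]
    exact (hextends i t ht).symm
  rw [Part.mem_unique hrun (hf m)]
  exact hψ.1.2.2.1 _ ⟨_, ⟨m, rfl⟩, rfl⟩

theorem append_mem_graphSet (ψ : (Fin k → ℝ) → (Fin l → ℝ)) (x : Fin k → ℝ) :
    Fin.append x (ψ x) ∈ graphSet ψ := by
  simp only [graphSet, Set.mem_ofPred_eq, Fin.append_left, Fin.append_right]

theorem isPredictive_of_isBasicRepresentation (hc : 0 < c) {ψ ψ' : (Fin k → ℝ) → (Fin l → ℝ)}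
    {κ : Fin l → OracleCode k} (hκ : ComputesOnNestedOracles c ψ' κ)
    (hR : ((decimalBasis c).power (k + l)).IsBasicRepresentation (constructedStates c κ)
      (graphSet ψ)) : IsPredictive c (constructedStates c κ) ψ := by
  have hsound (z : Fin (k + l) → ℤ × ℕ) (hz : boxCode c z ∈ constructedStates c κ) (x : Fin k → ℝ)
      (hx : ∀ i, x i ∈ decimalInterval c (z (Fin.castAdd l i))) (j : Fin l) :
      ψ' x j ∈ decimalInterval c (z (Fin.natAdd k j)) := by
    simp only [← iota_decimalCode] at hx ⊢
    exact mem_iota_of_mem_constructedStates hc hκ hz hx j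
  have hprecise (y) (hy : y ∈ graphSet ψ) (d : ℕ) :=
    exists_boxCode_mem_of_isBasicRepresentation hc hR hy d
  have hψ : ψ' = ψ := by
    ext x j
    refine eq_of_forall_mem_decimalInterval_decimalApprox hc fun d => ?_
    obtain ⟨z, hzR, hz⟩ := hprecise _ (append_mem_graphSet ψ x) d
    have hx := fun i => (hz (Fin.castAdd l i)).2.1
    have hsub := (hz (Fin.natAdd k j)).2.2
    simp only [Fin.append_left] at hx
    rw [Fin.append_right] at hsub
    exact hsub (hsound z hzR x hx j)
  exact ⟨hψ ▸ hsound, hprecise⟩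

end Prediction

section Predictor

variable {k l : ℕ} {c : ℚ}

/-- The data `(y, z, N)` that a predictor searches for: `y` gives the values of the oracles, `z`
the sides of a box, and `N` bounds the running time of the program that accepts the code of the
box. -/
abbrev Evidence (k l : ℕ) : Type := (Fin k → ℤ × ℕ) × (Fin (k + l) → ℤ × ℕ) × ℕ

/-- The `j`-th output coordinate of the box is the predicted interval. -/
def Evidence.prediction (j : Fin l) (w : Evidence k l) : ℤ × ℕ := w.2.1 (Fin.natAdd k j)

/-- When `V` are the values of the oracles and `e` accepts the codes in the representation, the
evidence `w` justifies a prediction for the `j`-th coordinate that improves on the prediction from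
the earlier evidence `q`. -/
structure IsImprovement (c : ℚ) (j : Fin l) (e : Code) (q : Option (Evidence k l))
    (V : Fin k → ℕ) (w : Evidence k l) : Prop where
  oracle : ∀ i, V i = decimalCode c (w.1 i).1 (w.1 i).2 ∧
    decimalInterval c (w.1 i) ⊆ decimalInterval c (w.2.1 (Fin.castAdd l i))
  accepted : (Code.evaln w.2.2 e (boxCode c w.2.1)).isSome
  pos : 0 < (w.prediction j).2
  improves : ∀ w' ∈ q, (w'.prediction j).2 < (w.prediction j).2 ∧
    decimalInterval c (w.prediction j) ⊆ decimalInterval c (w'.prediction j)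

theorem primrec_boxCode (c : ℚ) (n : ℕ) : Primrec (boxCode c : (Fin n → ℤ × ℕ) → ℕ) := by
  have hside : Primrec₂ fun (z : Fin n → ℤ × ℕ) i => z i := Primrec.fin_app
  exact (primrec_tupleCode n).comp (Primrec.fin_curry.2
    ((primrec_decimalCode c).comp (Primrec.fst.comp hside) (Primrec.snd.comp hside)))

theorem primrec_prediction (j : Fin l) : Primrec (Evidence.prediction (k := k) j) :=
  Primrec.fin_app.comp (Primrec.fst.comp Primrec.snd) (Primrec.const (Fin.natAdd k j))

theorem primrecRel_isImprovement (hc : 0 < c) (j : Fin l) :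
    PrimrecRel fun (p : (Code × Option (Evidence k l)) × (Fin k → ℕ)) (w : Evidence k l) =>
      IsImprovement c j p.1.1 p.1.2 p.2 w := by
  let Input := ((Code × Option (Evidence k l)) × (Fin k → ℕ)) × Evidence k l
  have hsubset := primrecRel_decimalInterval_subset hc
  have hy (i) : Primrec fun p : Input => p.2.1 i :=
    Primrec.fin_app.comp (Primrec.fst.comp Primrec.snd) (Primrec.const i)
  have hz : Primrec fun p : Input => p.2.2.1 := Primrec.fst.comp (Primrec.snd.comp Primrec.snd)
  have hN : Primrec fun p : Input => p.2.2.2 := Primrec.snd.comp (Primrec.snd.comp Primrec.snd)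
  have hV (i) : Primrec fun p : Input => p.1.2 i :=
    Primrec.fin_app.comp (Primrec.snd.comp Primrec.fst) (Primrec.const i)
  have he : Primrec fun p : Input => p.1.1.1 := Primrec.fst.comp (Primrec.fst.comp Primrec.fst)
  have hq : Primrec fun p : Input => p.1.1.2 := Primrec.snd.comp (Primrec.fst.comp Primrec.fst)
  have horacle (i) := (Primrec.eq.comp (hV i) ((primrec_decimalCode c).comp
    (Primrec.fst.comp (hy i)) (Primrec.snd.comp (hy i)))).and
      (hsubset.comp (hy i) (Primrec.fin_app.comp hz (Primrec.const (Fin.castAdd l i))))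
  have haccepted := Primrec.eq.comp (Primrec.option_isSome.comp (Code.primrec_evaln.comp
    ((hN.pair he).pair ((primrec_boxCode c (k + l)).comp hz)))) (Primrec.const true)
  have hprediction := primrec_prediction (k := k) j
  have hpos := Primrec.nat_lt.comp (Primrec.const 0)
    (Primrec.snd.comp (hprediction.comp (Primrec.snd : Primrec fun p : Input => p.2)))
  have himproves : PrimrecRel fun w' w : Evidence k l =>
      (w'.prediction j).2 < (w.prediction j).2 ∧
        decimalInterval c (w.prediction j) ⊆ decimalInterval c (w'.prediction j) :=
    (Primrec.nat_lt.comp (Primrec.snd.comp (hprediction.comp Primrec.fst))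
      (Primrec.snd.comp (hprediction.comp Primrec.snd))).and
      (hsubset.comp (hprediction.comp Primrec.snd) (hprediction.comp Primrec.fst))
  have hall := (primrecPred_forall_fin horacle).and (haccepted.and (hpos.and
    (himproves.forall_mem_list.comp (Primrec.optionToList.comp hq) Primrec.snd)))
  refine PrimrecPred.of_eq hall fun p => ?_
  simp only [Option.mem_toList]
  exact ⟨fun ⟨h₁, h₂, h₃, h₄⟩ => ⟨h₁, h₂, h₃, h₄⟩, fun ⟨h₁, h₂, h₃, h₄⟩ => ⟨h₁, h₂, h₃, h₄⟩⟩

theorem IsImprovement.mem_prediction {R : Set ℕ} {ψ : (Fin k → ℝ) → (Fin l → ℝ)}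
    (hR : IsPredictive c R ψ) {e : Code} (he : SemiDecides e R) {x : Fin k → ℝ} {V : Fin k → ℕ}
    (hV : ∀ i, x i ∈ iota (V i)) {j : Fin l} {q : Option (Evidence k l)} {w : Evidence k l}
    (h : IsImprovement c j e q V w) : ψ x j ∈ decimalInterval c (w.prediction j) := by
  obtain ⟨v, hv⟩ := Option.isSome_iff_exists.1 h.accepted
  have haccepted : boxCode c w.2.1 ∈ R :=
    (he _).1 (Part.dom_iff_mem.2 ⟨v, Code.evaln_sound hv⟩)
  refine hR.sound w.2.1 haccepted x (fun i => (h.oracle i).2 ?_) j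
  rw [← iota_decimalCode, ← (h.oracle i).1]
  exact hV i

theorem exists_forall_decimalInterval_subset (hc : 0 < c) {x : Fin k → ℝ} {φ : Fin k → ℕ → ℕ}
    (hφ : ∀ i, (decimalBasis c).IsNestedOracle (φ i) (x i)) {z : Fin k → ℤ × ℕ}
    (hz : ∀ i, 0 < (z i).2 ∧ x i ∈ decimalInterval c (z i)) :
    ∃ (t : ℕ) (y : Fin k → ℤ × ℕ), ∀ i, φ i t = decimalCode c (y i).1 (y i).2 ∧
      decimalInterval c (y i) ⊆ decimalInterval c (z i) := by
  have hlocal (i : Fin k) : ∃ t, iota (φ i t) ⊆ decimalInterval c (z i) := by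
    obtain ⟨_, ⟨_, ⟨t, rfl⟩, rfl⟩, ht⟩ := (hφ i).1.2.2.2 _
      ((mem_dom_decimalBasis_iff hc).2 ⟨z i, (hz i).1, rfl⟩)
      ((iota_decimalCode c (z i)).ge (hz i).2)
    exact ⟨t, iota_decimalCode c (z i) ▸ ht⟩
  choose t ht using hlocal
  choose y _ hy using fun i => (mem_dom_decimalBasis_iff hc).1 ((hφ i).1.1 (Finset.univ.sup t))
  refine ⟨Finset.univ.sup t, y, fun i => ⟨hy i, ?_⟩⟩
  have hnested : Antitone fun m => iota (φ i m) := antitone_nat_of_succ_le (hφ i).2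
  rw [← iota_decimalCode, ← hy i]
  exact (hnested (Finset.le_sup (Finset.mem_univ i))).trans (ht i)

theorem exists_decimalApprox_improves (hc : 0 < c) {x : ℝ} {q : Option (ℤ × ℕ)}
    (hq : ∀ z ∈ q, x ∈ decimalInterval c z) :
    ∃ d, ∀ z ∈ q, z.2 ≤ d ∧ decimalInterval c (decimalApprox x (d + 1)) ⊆ decimalInterval c z := by
  cases q with
  | none => exact ⟨0, fun _ hz => absurd hz (Option.not_mem_none _)⟩
  | some z =>
    obtain ⟨N, hN⟩ := exists_decimalInterval_subset_Ioo c (hq z rfl).1 (hq z rfl).2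
    refine ⟨max N z.2, fun z' hz' => ?_⟩
    obtain rfl : z = z' := Option.some.inj hz'
    exact ⟨le_max_right _ _, hN _ (Nat.le_succ_of_le (le_max_left _ _))
      (mem_decimalInterval_decimalApprox hc x _)⟩

theorem exists_isImprovement (hc : 0 < c) {R : Set ℕ} {ψ : (Fin k → ℝ) → (Fin l → ℝ)}
    (hR : IsPredictive c R ψ) {e : Code} (he : SemiDecides e R) {x : Fin k → ℝ}
    {φ : Fin k → ℕ → ℕ} (hφ : ∀ i, (decimalBasis c).IsNestedOracle (φ i) (x i)) {j : Fin l}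
    {q : Option (Evidence k l)} (hq : ∀ w ∈ q, ψ x j ∈ decimalInterval c (w.prediction j)) :
    ∃ t w, IsImprovement c j e q (fun i => φ i t) w := by
  obtain ⟨d, hd⟩ : ∃ d, ∀ w ∈ q, (w.prediction j).2 ≤ d ∧
      decimalInterval c (decimalApprox (ψ x j) (d + 1)) ⊆ decimalInterval c (w.prediction j) := by
    have := exists_decimalApprox_improves hc (x := ψ x j) (q := q.map (·.prediction j))
    simp only [Option.forall_mem_map] at this
    exact this hq
  obtain ⟨z, hzR, hz⟩ := hR.precise _ (append_mem_graphSet ψ x) d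
  have hinput := fun i => hz (Fin.castAdd l i)
  obtain ⟨hpos, -, houtput⟩ := hz (Fin.natAdd k j)
  simp only [Fin.append_left] at hinput
  rw [Fin.append_right] at houtput
  obtain ⟨t, y, hy⟩ := exists_forall_decimalInterval_subset hc hφ fun i =>
    ⟨(hinput i).1, (hinput i).2.1⟩
  obtain ⟨v, hv⟩ := Part.dom_iff_mem.1 ((he _).2 hzR)
  obtain ⟨N, hN⟩ := Code.evaln_complete.1 hv
  exact ⟨t, (y, z, N), hy, Option.isSome_iff_exists.2 ⟨v, hN⟩, hpos, fun w hw =>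
    ⟨Nat.lt_of_succ_le ((Nat.succ_le_succ (hd w hw).1).trans
      (snd_le_snd_of_decimalInterval_subset hc houtput)), houtput.trans (hd w hw).2⟩⟩

theorem exists_predictor (k : ℕ) (hc : 0 < c) (j : Fin l) :
    ∃ κ : OracleCode k, ∀ (R : Set ℕ) (ψ : (Fin k → ℝ) → (Fin l → ℝ)), IsPredictive c R ψ →
      ∀ e, SemiDecides e R → ∀ (x : Fin k → ℝ) (φ : Fin k → ℕ → ℕ),
        (∀ i, (decimalBasis c).IsNestedOracle (φ i) (x i)) → ∃ f : ℕ → ℕ,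
          (∀ m, f m ∈ κ.eval (fun i => (φ i : ℕ →. ℕ)) (Nat.pair (encode e) m)) ∧
          (decimalBasis c).IsNestedOracle f (ψ x j) := by
  obtain ⟨search, hsearch⟩ :=
    OracleCode.exists_iterated_search (primrecRel_isImprovement (k := k) hc j)
  have hprediction := primrec_prediction (k := k) j
  obtain ⟨output, houtput⟩ := OracleCode.exists_encode_mem_eval_of_computable (k := k)
    ((primrec_decimalCode c).comp (Primrec.fst.comp hprediction)
      (Primrec.snd.comp hprediction)).to_comp
  refine ⟨.comp output search, fun R ψ hR e he x φ hφ => ?_⟩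
  have hmem {q w t} (h : IsImprovement c j e q (fun i => φ i t) w) :
      ψ x j ∈ decimalInterval c (w.prediction j) :=
    h.mem_prediction hR he fun i => (hφ i).1.2.2.1 _ ⟨_, ⟨t, rfl⟩, rfl⟩
  obtain ⟨w, hw, ⟨t, hfirst⟩, hnext⟩ := hsearch φ e fun q hq => exists_isImprovement hc hR he hφ
    fun w hw => let ⟨_, _, h⟩ := hq w hw; hmem h
  choose t' hnext using hnext
  have himproves (m : ℕ) := (hnext m).improves (w m) rfl
  refine ⟨_, fun m => OracleCode.mem_eval_comp.2 ⟨_, hw m, houtput _ (w m)⟩,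
    isNestedOracle_decimalCode (z := fun m => (w m).prediction j) (fun m => ?_) (fun m => ?_)
      (fun m => (himproves m).2) fun N => ⟨N, ?_⟩⟩
  · cases m with
    | zero => exact hfirst.pos
    | succ m => exact (hnext m).pos
  · cases m with
    | zero => exact hmem hfirst
    | succ m => exact hmem (hnext m)
  · exact (strictMono_nat_of_lt_succ fun m => (himproves m).1).le_apply

theorem exists_computable_predictor (k l : ℕ) (hc : 0 < c) :
    ∃ G : Code → Fin l → OracleCode k, (∀ j, Computable fun e => (G e j).toNat) ∧
      ∀ (R : Set ℕ) (ψ : (Fin k → ℝ) → (Fin l → ℝ)), IsPredictive c R ψ →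
        ∀ e, SemiDecides e R → ComputesOnNestedOracles c ψ (G e) := by
  choose κ hκ using exists_predictor (l := l) k hc
  refine ⟨fun e j => (κ j).curry (encode e),
    fun j => (OracleCode.primrec_toNat_curry (κ j)).to_comp.comp Computable.encode,
    fun R ψ hR e he x φ hφ j => ?_⟩
  obtain ⟨f, hf, hψ⟩ := hκ j R ψ hR e he x φ hφ
  exact ⟨f, fun m => OracleCode.mem_eval_curry (hf m), hψ⟩

end Predictor

section ComputableModel

theorem exists_primrec_bijOn {α : Type*} [Primcodable α] [Inhabited α] {P : α → ℕ → Prop}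
    (hP : PrimrecRel P) : ∃ (T : Set ℕ) (x : ℕ → α), PrimrecPred (· ∈ T) ∧ Primrec x ∧
      Function.Surjective x ∧ Set.BijOn x T {a | ∃ N, P a N} := by
  classical
  let T : Set (α × ℕ) := {p | P p.1 p.2 ∧ ∀ M < p.2, ¬ P p.1 M}
  let x : ℕ → α := fun s => ((Encodable.decode (α := α × ℕ) s).getD default).1
  have hT : PrimrecPred (· ∈ T) := (hP.comp .fst .snd).and
    ((hP.swap.not.forall_mem_list.comp (Primrec.list_range.comp .snd) .fst).of_eq fun p => by
      simp only [List.mem_range, Function.swap])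
  have hx (a : α) (N : ℕ) : x (encode (a, N)) = a := by
    simp only [x, Encodable.encodek, Option.getD_some]
  refine ⟨encode '' T, x, ?_, ?_, fun a => ⟨_, hx a 0⟩, ?_, ?_, ?_⟩
  · have hmem : PrimrecRel fun (_ : Unit) p => p ∈ T := hT.comp Primrec.snd
    refine ((primrecRel_exists_encode_eq hmem).comp (Primrec.const ()) Primrec.id).of_eq fun s => ?_
    simp only [Set.mem_image, and_comm, id]
  · exact Primrec.fst.comp (Primrec.option_getD.comp Primrec.decode (Primrec.const default))
  · rintro _ ⟨⟨a, N⟩, ⟨hN, -⟩, rfl⟩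
    exact (hx a N).symm ▸ ⟨N, hN⟩
  · rintro _ ⟨⟨a, N⟩, ⟨hN, hmin⟩, rfl⟩ _ ⟨⟨a', N'⟩, ⟨hN', hmin'⟩, rfl⟩ haa'
    obtain rfl : a = a' := by simpa only [hx] using haa'
    obtain rfl : N = N' := le_antisymm (not_lt.1 fun h => hmin _ h hN')
      (not_lt.1 fun h => hmin' _ h hN)
    rfl
  · intro a ha
    exact ⟨_, ⟨(a, Nat.find ha), ⟨Nat.find_spec ha, fun _ => Nat.find_min ha⟩, rfl⟩, hx a _⟩

theorem isModelIso_invFunOn {R T : Set ℕ} {A : Set (ℕ → ℕ)} {h : ℕ → ℕ} (hh : Set.BijOn h T R)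
    (hA : Set.InjOn (fun α => α ∘ h) A) :
    IsModelIso R A T ((fun α => α ∘ h) '' A) (Function.invFunOn h T) fun α => α ∘ h :=
  ⟨hh.symm hh.invOn_invFunOn.symm, hA.bijOn_image,
    fun _ hs α _ => congrArg α (hh.invOn_invFunOn.2 hs).symm⟩

theorem injOn_comp_tupleCode {n : ℕ} {x : ℕ → Fin n → ℕ} (hx : Function.Surjective x) :
    Set.InjOn (fun α => α ∘ tupleCode n ∘ x) (Set.range (projection n)) := by
  rintro _ ⟨i, rfl⟩ _ ⟨i', rfl⟩ h
  obtain ⟨s, hs⟩ := hx fun i => i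
  have hval := congrFun h s
  simp only [Function.comp_apply, projection_tupleCode, hs, Fin.val_inj] at hval
  rw [hval]

theorem exists_computableModel {n : ℕ} {R : Set ℕ} {e : Code} (he : SemiDecides e R)
    (hR : R ⊆ Set.range (tupleCode n)) :
    ∃ T B f g, IsComputableModel T B ∧ IsModelIso R (Set.range (projection n)) T B f g := by
  have hevaln : PrimrecRel fun (u : Fin n → ℕ) N => (Code.evaln N e (tupleCode n u)).isSome :=
    Primrec.eq.comp (Primrec.option_isSome.comp (Code.primrec_evaln.comp
      ((Primrec.snd.pair (Primrec.const e)).pair ((primrec_tupleCode n).comp Primrec.fst))))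
      (Primrec.const true)
  obtain ⟨T, x, hT, hxprim, hsurj, hbij⟩ := exists_primrec_bijOn hevaln
  have hhalts : {u | ∃ N, (Code.evaln N e (tupleCode n u)).isSome} = tupleCode n ⁻¹' R := by
    ext u
    rw [Set.mem_preimage, ← he, Part.dom_iff_mem]
    simp only [Code.evaln_complete, Option.isSome_iff_exists, Set.mem_ofPred_eq, Option.mem_def]
    exact exists_comm
  rw [hhalts] at hbij
  have hcode := (tupleCode_injective n).injOn.bijOn_image (s := tupleCode n ⁻¹' R)
  rw [Set.image_preimage_eq_of_subset hR] at hcode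
  refine ⟨T, _, _, _, ⟨hT.computablePred, ?_⟩,
    isModelIso_invFunOn (hcode.comp hbij) (injOn_comp_tupleCode hsurj)⟩
  rintro _ ⟨_, ⟨i, rfl⟩, rfl⟩
  refine ((Primrec.fin_app.comp hxprim (Primrec.const i)).of_eq fun s => ?_).to_comp
  simp only [Function.comp_apply, projection_tupleCode, id]

variable {n : ℕ} {R T : Set ℕ} {B : Set (ℕ → ℕ)} {β : Fin n → ℕ → ℕ} {f : ℕ → ℕ}
  {g : (ℕ → ℕ) → (ℕ → ℕ)}

theorem IsModelIso.tupleCode_apply_eq (h : IsModelIso R (Set.range (projection n)) T B f g)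
    (hR : R ⊆ Set.range (tupleCode n)) (hg : ∀ i, g (projection n i) = β i) {r : ℕ} (hr : r ∈ R) :
    tupleCode n (fun i => β i (f r)) = r := by
  obtain ⟨u, rfl⟩ := hR hr
  congr 1 with i
  rw [← hg, ← h.2.2 _ hr _ ⟨i, rfl⟩, projection_tupleCode]

theorem IsModelIso.mem_iff (h : IsModelIso R (Set.range (projection n)) T B f g)
    (hR : R ⊆ Set.range (tupleCode n)) (hg : ∀ i, g (projection n i) = β i) {r : ℕ} :
    r ∈ R ↔ ∃ s ∈ T, r = tupleCode n fun i => β i s := by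
  constructor
  · exact fun hr => ⟨f r, h.1.mapsTo hr, (h.tupleCode_apply_eq hR hg hr).symm⟩
  · rintro ⟨s, hs, rfl⟩
    obtain ⟨r, hr, rfl⟩ := h.1.surjOn hs
    rwa [h.tupleCode_apply_eq hR hg hr]

theorem Decides.one_mem_eval_iff {t : Code} (ht : Decides t T) {s : ℕ} :
    1 ∈ t.eval s ↔ s ∈ T := by
  by_cases hs : s ∈ T
  · simp only [(ht s).1 hs, Part.mem_some, hs]
  · simp only [(ht s).2 hs, Part.mem_some_iff, one_ne_zero, hs]

theorem exists_mem_evaln_iff {ι : Type*} [Finite ι] {t : Code} {b : ι → Code} {s v : ℕ}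
    {x : ι → ℕ} :
    (∃ N, v ∈ Code.evaln N t s ∧ ∀ i, x i ∈ Code.evaln N (b i) s) ↔
      v ∈ t.eval s ∧ ∀ i, x i ∈ (b i).eval s := by
  constructor
  · exact fun ⟨N, ht, hb⟩ => ⟨Code.evaln_sound ht, fun i => Code.evaln_sound (hb i)⟩
  · rintro ⟨ht, hb⟩
    cases nonempty_fintype ι
    obtain ⟨M, hM⟩ := Code.evaln_complete.1 ht
    choose N hN using fun i => Code.evaln_complete.1 (hb i)
    exact ⟨max M (Finset.univ.sup N), Code.evaln_mono (le_max_left _ _) hM, fun i =>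
      Code.evaln_mono (le_max_of_le_right (Finset.le_sup (Finset.mem_univ i))) (hN i)⟩

theorem primrecRel_eq_tupleCode_and_mem_evaln (n : ℕ) :
    PrimrecRel fun (p : (Code × (Fin n → Code)) × ℕ) (w : ℕ × (Fin n → ℕ) × ℕ) =>
      p.2 = tupleCode n w.2.1 ∧ 1 ∈ Code.evaln w.2.2 p.1.1 w.1 ∧
        ∀ i, w.2.1 i ∈ Code.evaln w.2.2 (p.1.2 i) w.1 := by
  let Input := ((Code × (Fin n → Code)) × ℕ) × ℕ × (Fin n → ℕ) × ℕ
  have hs : Primrec fun q : Input => q.2.1 := Primrec.fst.comp Primrec.snd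
  have hx : Primrec fun q : Input => q.2.2.1 := Primrec.fst.comp (Primrec.snd.comp Primrec.snd)
  have hN : Primrec fun q : Input => q.2.2.2 := Primrec.snd.comp (Primrec.snd.comp Primrec.snd)
  have ht : Primrec fun q : Input => q.1.1.1 := Primrec.fst.comp (Primrec.fst.comp Primrec.fst)
  have hb (i) : Primrec fun q : Input => q.1.1.2 i := Primrec.fin_app.comp
    (Primrec.snd.comp (Primrec.fst.comp Primrec.fst)) (Primrec.const i)
  have hcode := Primrec.eq.comp (Primrec.snd.comp Primrec.fst : Primrec fun q : Input => q.1.2)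
    ((primrec_tupleCode n).comp hx)
  have hdecides := Primrec.eq.comp (Code.primrec_evaln.comp ((hN.pair ht).pair hs))
    (Primrec.const (some 1))
  have hvalue (i : Fin n) := Primrec.eq.comp (Code.primrec_evaln.comp ((hN.pair (hb i)).pair hs))
    (Primrec.option_some.comp (Primrec.fin_app.comp hx (Primrec.const i)))
  exact hcode.and (hdecides.and (primrecPred_forall_fin hvalue))

theorem exists_semiDecides_of_model (n : ℕ) :
    ∃ E : Code × (Fin n → Code) → Code, Computable E ∧
      ∀ {R T : Set ℕ} {β : Fin n → ℕ → ℕ} {f : ℕ → ℕ} {g : (ℕ → ℕ) → (ℕ → ℕ)} {t : Code}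
        {b : Fin n → Code}, R ⊆ Set.range (tupleCode n) →
        IsModelIso R (Set.range (projection n)) T (Set.range β) f g →
        (∀ i, g (projection n i) = β i) → Decides t T →
        (∀ i s, (b i).eval s = Part.some (β i s)) → SemiDecides (E (t, b)) R := by
  obtain ⟨E, hE, hsemi⟩ := exists_computable_semiDecides (primrecRel_eq_tupleCode_and_mem_evaln n)
  refine ⟨E, hE, fun {R T β f g t b} hR hiso hg ht hb => ?_⟩
  convert hsemi (t, b) using 1
  ext r
  simp only [hiso.mem_iff hR hg, Set.mem_ofPred_eq, Prod.exists, exists_and_left,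
    exists_mem_evaln_iff, ht.one_mem_eval_iff, hb, Part.mem_some_iff, ← funext_iff]
  constructor
  · rintro ⟨s, hs, rfl⟩
    exact ⟨s, _, rfl, hs, rfl⟩
  · rintro ⟨s, x, rfl, hs, rfl⟩
    exact ⟨s, hs, rfl⟩

end ComputableModel

theorem constructedStates_subset_range_tupleCode {k l : ℕ} (c : ℚ) (κ : Fin l → OracleCode k) :
    constructedStates c κ ⊆ Set.range (tupleCode (k + l)) := by
  rintro _ ⟨u, rfl, -⟩
  exact ⟨u, rfl⟩

theorem mainTheorem2 (k l : ℕ) (hl : 0 < l) (c : ℚ) (hc : 0 < c) :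
    -- programs for the functionals are obtained effectively from a program for `R`
    (∃ G : Nat.Partrec.Code → Fin l → OracleCode k,
      (∀ j, Computable fun e => (G e j).toNat) ∧
      ∀ (R : Set ℕ) (H : Set (ℕ → ℕ)) (ψ : (Fin k → ℝ) → (Fin l → ℝ)),
        (R, H) ∈ kreiselRepresentations k l c →
        ((decimalBasis c).power (k + l)).IsBasicRepresentation R (graphSet ψ) →
        (∃ e, SemiDecides e R) ∧
        ∀ e, SemiDecides e R → ComputesOnNestedOracles c ψ (G e)) ∧
    -- and from programs for any computable physical model isomorphic to `(R, H)`
    (∃ P : Nat.Partrec.Code × (Fin (k + l) → Nat.Partrec.Code) → Fin l → OracleCode k,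
      (∀ j, Computable fun q => (P q j).toNat) ∧
      ∀ (R : Set ℕ) (H : Set (ℕ → ℕ)) (ψ : (Fin k → ℝ) → (Fin l → ℝ)),
        (R, H) ∈ kreiselRepresentations k l c →
        ((decimalBasis c).power (k + l)).IsBasicRepresentation R (graphSet ψ) →
        (∃ T B f g, IsComputableModel T B ∧ IsModelIso R H T B f g) ∧
        ∀ (T : Set ℕ) (β : Fin (k + l) → ℕ → ℕ) (f : ℕ → ℕ) (g : (ℕ → ℕ) → (ℕ → ℕ))
          (t : Nat.Partrec.Code) (b : Fin (k + l) → Nat.Partrec.Code),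
          IsModelIso R H T (Set.range β) f g → (∀ i, g (projection (k + l) i) = β i) →
          Decides t T → (∀ i s, (b i).eval s = Part.some (β i s)) →
          ComputesOnNestedOracles c ψ (P (t, b))) := by
  obtain ⟨G, hG, hpredict⟩ := exists_computable_predictor k l hc
  obtain ⟨E, hE, hmodel⟩ := exists_semiDecides_of_model (k + l)
  refine ⟨⟨G, hG, ?_⟩, fun q => G (E q), fun j => (hG j).comp hE, ?_⟩
  · rintro R H ψ ⟨ψ', κ', hκ', hRH⟩ hR
    obtain ⟨rfl, rfl⟩ := Prod.mk.inj hRH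
    exact ⟨exists_semiDecides_constructedStates c κ',
      hpredict _ ψ (isPredictive_of_isBasicRepresentation hc hκ' hR)⟩
  · rintro R H ψ ⟨ψ', κ', hκ', hRH⟩ hR
    obtain ⟨rfl, rfl⟩ := Prod.mk.inj hRH
    have hrange := constructedStates_subset_range_tupleCode c κ'
    obtain ⟨e, he⟩ := exists_semiDecides_constructedStates c κ'
    exact ⟨exists_computableModel he hrange, fun T β f g t b hiso hg ht hb =>
      hpredict _ ψ (isPredictive_of_isBasicRepresentation hc hκ' hR) _
        (hmodel hrange hiso hg ht hb)⟩
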